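/- Let $1\le p\le q$ be integers, let $\mathrm B_{p,q}$ be the set of real $p\times q$ matrices $z$ for which $v\mapsto vz$ has norm $<1$ as an operator from Euclidean $\mathbb R^p$ to Euclidean $\mathbb R^q$. This is a model of $\mathrm O(p,q)/\mathrm O(p)\times\mathrm O(q)$, with the action $z\mapsto (a+zc)^{-1}(b+zd)$ of $\begin{pmatrix}a&b\\c&d\end{pmatrix}\in\mathrm O(p,q)$ and the invariant measure $$d\lambda(z)=\det(1-z^tz)^{-(p+q)/2}\,dz ,$$ $dz$ being Lebesgue measure. For $z=(z_1\ z_2)\in\mathrm B_{p,q}$, with $z_1$ of size $p\times(q-p)$ and $z_2$ of size $p\times p$, put $\widetilde z=\begin{pmatrix}0&0\\z_1&z_2\end{pmatrix}$ and write $$(1-\widetilde z)(1+\widetilde z)^{-1}=\begin{pmatrix}1&0\\2L&M+N\end{pmatrix},\qquad M=M^t,\quad N=-N^t .$$ For $s\in\mathbb C^p$ let $$\Psi_s(z)=\prod_{j=1}^p\det[M-LL^t]_j^{(-\theta_j+s_j-s_{j+1})/2},\qquad s_{p+1}=0,\quad \theta_1=\dots=\theta_{p-1}=1,\quad \theta_p=1-\tfrac{p+q}2,$$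 where $[A]_j$ is the upper left $j\times j$ block of $A$. Let $$\Phi_s(z)=\int_{\mathrm O(p)\times \mathrm O(q)}\Psi_s(a^{-1}zd)\,da\,dd$$ (Haar measure of total mass $1$) be the spherical function, and let $\widehat f(s)=\int_{\mathrm B_{p,q}}\Phi_s(z)f(z)\,d\lambda(z)$ be the spherical transform of an $\mathrm O(p)\times\mathrm O(q)$-invariant function $f$. Corollary 3.4. Let $\alpha>p+q-1$ be real and let $\mathcal B_\alpha(z)=\det(1-zz^t)^{\alpha/2}$. Then for every $s\in\mathbb C^p$ with $|\operatorname{Re}s_k|<\alpha-\frac{p+q}2+1$ for $k=1,\dots,p$, the function $\Phi_s\mathcal B_\alpha$ is $\lambda$-integrable and $$\widehat{\mathcal B_\alpha}(s)=\frac{2^{p(\alpha-(p+1)/2)}\,\pi^{p(q-1)/2}}{\prod_{j=1}^p\Gamma(\alpha-j+1)}\ \prod_{k=1}^p\Gamma\Bigl(\tfrac12\bigl(\alpha-\tfrac{p+q}2+1+s_k\bigr)\Bigr)\,\Gamma\Bigl(\tfrac12\bigl(\alpha-\tfrac{p+q}2+1-s_k\bigr)\Bigr).$$ -/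

import Mathlib

open MeasureTheory

noncomputable section

namespace BerezinTransform

/-- Lebesgue measure on real `p × q` matrices, the coordinates being the matrix entries
(the σ-algebra is the Borel one). -/
instance instMeasureSpaceMatrix (p q : ℕ) : MeasureSpace (Matrix (Fin p) (Fin q) ℝ) :=
  inferInstanceAs (MeasureSpace (Fin p → Fin q → ℝ))

instance instBorelSpaceMatrix (p q : ℕ) : BorelSpace (Matrix (Fin p) (Fin q) ℝ) :=
  inferInstanceAs (BorelSpace (Fin p → Fin q → ℝ))

/-- `O(n)` is compact, so that its Haar measure can be normalized. -/
instance instCompactSpaceOrthogonalGroup (n : ℕ) :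
    CompactSpace (Matrix.orthogonalGroup (Fin n) ℝ) := by
  refine (isCompact_iff_compactSpace
    (s := (Matrix.orthogonalGroup (Fin n) ℝ : Set (Matrix (Fin n) (Fin n) ℝ)))).mp ?_
  have hK : IsCompact (Set.pi Set.univ fun _ : Fin n =>
      Set.pi Set.univ fun _ : Fin n => Set.Icc (-1 : ℝ) 1) :=
    isCompact_univ_pi fun _ => isCompact_univ_pi fun _ => isCompact_Icc
  have hcl : IsClosed {A : Matrix (Fin n) (Fin n) ℝ | A * A.transpose = 1} :=
    isClosed_eq (by fun_prop) continuous_const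
  refine IsCompact.of_isClosed_subset (X := Matrix (Fin n) (Fin n) ℝ) hK ?_ ?_
  · convert hcl using 1
    ext A
    exact Matrix.mem_orthogonalGroup_iff (Fin n) ℝ
  · intro A hA i _ j _
    have h := entry_norm_bound_of_unitary (𝕜 := ℝ) hA i j
    rw [Real.norm_eq_abs, abs_le] at h
    exact h

/-- Haar measure on `O(n)`, the whole group having measure `1`. -/
def haarO (n : ℕ) : Measure (Matrix.orthogonalGroup (Fin n) ℝ) :=
  Measure.haarMeasure ⊤

/-- The matrix ball `B_{p,q}(ℝ)`, a model of `O(p,q)/(O(p) × O(q))`: real `p × q` matrices `z`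
for which the operator `v ↦ v z` (row vectors) from Euclidean `ℝ^p` to Euclidean `ℝ^q`
has norm `< 1`. -/
def matrixBall (p q : ℕ) : Set (Matrix (Fin p) (Fin q) ℝ) :=
  {z | ‖LinearMap.toContinuousLinearMap (Matrix.toEuclideanLin z.transpose)‖ < 1}

/-- The `O(p,q)`-invariant measure `dλ(z) = det(1 - zᵗ z)^{-(p+q)/2} dz` on the matrix ball,
`dz` being Lebesgue measure. The group `O(p,q)` acts on the ball by
`z ↦ (a + z c)⁻¹ (b + z d)`. -/
def invariantMeasure (p q : ℕ) : Measure (Matrix (Fin p) (Fin q) ℝ) :=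
  (volume.restrict (matrixBall p q)).withDensity fun z =>
    ENNReal.ofReal ((1 - z.transpose * z).det ^ (-((p : ℝ) + q) / 2))

/-- The function `𝓑_α(z) = det(1 - z zᵗ)^{α/2}` on the matrix ball. -/
def berezin {p q : ℕ} (α : ℝ) (z : Matrix (Fin p) (Fin q) ℝ) : ℝ :=
  (1 - z * z.transpose).det ^ (α / 2)

/-- The column indices of a `p × q` matrix, `p ≤ q`, split into the first `q - p` and
the last `p` ones. -/
def splitCols {p q : ℕ} (h : p ≤ q) : Fin (q - p) ⊕ Fin p ≃ Fin q :=
  finSumFinEquiv.trans (finCongr (Nat.sub_add_cancel h))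

/-- The embedding `z = (z₁ z₂) ↦ (0 0; z₁ z₂)` of `B_{p,q}` into the ball of square matrices
of size `(q - p) + p`. -/
def squareBlock {p q : ℕ} (h : p ≤ q) (z : Matrix (Fin p) (Fin q) ℝ) :
    Matrix (Fin (q - p) ⊕ Fin p) (Fin (q - p) ⊕ Fin p) ℝ :=
  Matrix.fromBlocks 0 0
    (Matrix.of fun i j => z i (splitCols h (Sum.inl j)))
    (Matrix.of fun i j => z i (splitCols h (Sum.inr j)))

/-- The Cayley transform `w ↦ (1 - w)/(1 + w)`. -/
def cayley {n : Type*} [Fintype n] [DecidableEq n] (w : Matrix n n ℝ) : Matrix n n ℝ :=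
  (1 - w) * (1 + w)⁻¹

/-- The symmetric matrix `M - L Lᵗ` of a point `R = (1 0; 2L, M + N)` of the section of the wedge,
where `M` is symmetric and `N` is skew-symmetric. -/
def wedgeSchur {m p : ℕ} (R : Matrix (Fin m ⊕ Fin p) (Fin m ⊕ Fin p) ℝ) :
    Matrix (Fin p) (Fin p) ℝ :=
  let L := (1 / 2 : ℝ) • R.toBlocks₂₁
  let M := (1 / 2 : ℝ) • (R.toBlocks₂₂ + R.toBlocks₂₂.transpose)
  M - L * L.transpose

/-- The determinant of the upper left block of size `j + 1`, for `j = 0, …, p - 1`. -/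
def leadingMinor {p : ℕ} (A : Matrix (Fin p) (Fin p) ℝ) (j : Fin p) : ℝ :=
  (A.submatrix (Fin.castLE (Nat.succ_le_of_lt j.isLt))
    (Fin.castLE (Nat.succ_le_of_lt j.isLt))).det

/-- The exponents `(-θ_j + s_j - s_{j+1})/2`, where `s_{p+1} = 0`, `θ_1 = ⋯ = θ_{p-1} = 1` and
`θ_p = 1 - (p+q)/2`; the index `j` is shifted by one. Equivalently, the `j`-th and all later
exponents sum to `(s_j + (q-p)/2 + j - 1)/2`. -/
def psiExponent {p : ℕ} (q : ℕ) (s : Fin p → ℂ) (j : Fin p) : ℂ :=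
  if h : (j : ℕ) + 1 < p then (-1 + s j - s ⟨j + 1, h⟩) / 2
  else (-(1 - ((p : ℂ) + q) / 2) + s j) / 2

/-- The eigenfunction `Ψ_s = ∏_j det[M - L Lᵗ]_j^{(-θ_j + s_j - s_{j+1})/2}` of the minimal
parabolic subgroup, as a function on the matrix ball. -/
def psi {p q : ℕ} (h : p ≤ q) (s : Fin p → ℂ) (z : Matrix (Fin p) (Fin q) ℝ) : ℂ :=
  ∏ j : Fin p,
    ((leadingMinor (wedgeSchur (cayley (squareBlock h z))) j : ℝ) : ℂ) ^ psiExponent q s j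

/-- The spherical function `Φ_s`: the average of `Ψ_s` over `K = O(p) × O(q)`, where
`k = (a 0; 0 d)` acts on the matrix ball by `z ↦ a⁻¹ z d`. -/
def sphericalFunction {p q : ℕ} (h : p ≤ q) (s : Fin p → ℂ) (z : Matrix (Fin p) (Fin q) ℝ) : ℂ :=
  ∫ k, psi h s ((k.1⁻¹).val * z * k.2.val) ∂((haarO p).prod (haarO q))

/-- The spherical transform `f̂(s) = ∫_{G/K} Φ_s(z) f(z) dλ(z)`. -/
def sphericalTransform {p q : ℕ} (h : p ≤ q) (f : Matrix (Fin p) (Fin q) ℝ → ℂ)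
    (s : Fin p → ℂ) : ℂ :=
  ∫ z, sphericalFunction h s z * f z ∂(invariantMeasure p q)

end BerezinTransform

end

/-!
The spherical transform of `𝓑_α` equals `∫ Ψ_s 𝓑_α dλ`: the measure `λ` and `𝓑_α` are invariant
under `O(p) × O(q)`, so averaging `Ψ_s` over the group does not change the integral
(`integrable_sphericalFunction_mul_and_integral`).

In the Cayley coordinates `(L, X)`, `X = M + N`, one has
`1 - z zᵗ = (1 + z₂) Y (1 + z₂)ᵗ` with `Y = M - L Lᵗ`, so the ball becomes the set where `Y`
is positive definite. Up to a power of two, the Jacobian of the Cayley transform turns the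
integrand into `∏ d_j ^ E_j · |det(1 + X)|^{-α}`, where `d_j` are the pivots (successive Schur
complements) of `Y` (`psi_mul_density_eq_cayleyPullback`, `transfers_cayleyPullback`).

The integral of this function over all `(L, X)` is computed by induction on `p`
(`integrable_tubeDensity_and_integral`). Let `x`, `u`, `v` be the upper left entry and the
rest of the first row and column of `X`, and `l` the first row of `L`. The first pivot is
`y = x - |l|²`. If the other block `X'` of `X` is replaced by the Schur complement
`X' - v uᵗ/(1 + x)`, then `det(1 + X)` splits off the factor `1 + x`, and the Schur complement of
`Y` becomes again a matrix `(X' + X'ᵗ)/2 - P Q Pᵗ`; the rows of `P` are the remaining rows of `L`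
extended by the entries of `u` and `v`, and `Q` is a positive definite form depending on `x` and `l`
only. A linear substitution in the rows of `P` makes `Q` the identity
(`transfers_tubeDensitySplit`). This leaves the same integral with `p` diminished by one and two
more columns in `L`, hence the same `p + q`, times
`∫ y^{a-1} (1 + y + |l|²)^{-c} dy dl`, whose value is
`π^{m/2} Γ(a) Γ(c - a - m/2) / Γ(c)` (`integrable_radialDensity_and_integral`). So each step
produces one pair of Gamma functions of the formula.

Integrability is carried along with the values by the relation `Transfers`.
-/

namespace BerezinTransform

open Matrix

/-! ### Transfer of integrals -/

/-- If `F` is integrable, then so is `G`, with the same integral and the same `L¹` norm. This is how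
changes of variables are recorded: the `L¹` norm is what makes the notion stable under
fibering (`Transfers.prod`), since integrability on a product is tested on the `L¹` norms of
the fibers. -/
def Transfers {A B : Type*} [MeasurableSpace A] [MeasurableSpace B]
    (μ : Measure A) (ν : Measure B) (G : A → ℂ) (F : B → ℂ) : Prop :=
  Integrable F ν → Integrable G μ ∧ ∫ a, ‖G a‖ ∂μ = ∫ b, ‖F b‖ ∂ν ∧ ∫ a, G a ∂μ = ∫ b, F b ∂ν

namespace Transfers

variable {A B C : Type*} [MeasurableSpace A] [MeasurableSpace B] [MeasurableSpace C]
  {μ : Measure A} {ν : Measure B} {ρ : Measure C}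

theorem trans {H : A → ℂ} {G : B → ℂ} {F : C → ℂ} (h₁ : Transfers μ ν H G)
    (h₂ : Transfers ν ρ G F) : Transfers μ ρ H F := fun hF => by
  obtain ⟨a, b, c⟩ := h₂ hF
  obtain ⟨a', b', c'⟩ := h₁ a
  exact ⟨a', b'.trans b, c'.trans c⟩

theorem of_scaling {T : A → B} (hT : Measurable T) {d : ℝ} (hd : 0 < d)
    (hmap : μ.map T = ENNReal.ofReal d⁻¹ • ν) (F : B → ℂ) :
    Transfers μ ν (fun a => (d : ℂ) * F (T a)) F := fun hF => by
  have hd' : ENNReal.ofReal d⁻¹ ≠ ⊤ := ENNReal.ofReal_ne_top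
  have hF' : Integrable F (μ.map T) := by rw [hmap]; exact hF.smul_measure hd'
  have hd0 : (d : ℂ) ≠ 0 := by exact_mod_cast hd.ne'
  refine ⟨(hF'.comp_measurable hT).const_mul _, ?_, ?_⟩
  · have h := integral_map hT.aemeasurable hF'.norm.aestronglyMeasurable
    rw [hmap, integral_smul_measure, ENNReal.toReal_ofReal (by positivity)] at h
    simp only [norm_mul, Complex.norm_real, Real.norm_eq_abs, abs_of_pos hd]
    rw [integral_const_mul, ← h, smul_eq_mul, mul_inv_cancel_left₀ hd.ne']
  · have h := integral_map hT.aemeasurable hF'.aestronglyMeasurable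
    rw [hmap, integral_smul_measure, ENNReal.toReal_ofReal (by positivity)] at h
    rw [integral_const_mul, ← h, Complex.real_smul, Complex.ofReal_inv,
      mul_inv_cancel_left₀ hd0]

theorem of_measurePreserving {T : A → B} (hT : MeasurePreserving T μ ν) (F : B → ℂ) :
    Transfers μ ν (fun a => F (T a)) F := by
  simpa using of_scaling hT.measurable one_pos (by simp [hT.map_eq]) F

theorem of_linearMap {E : Type*} [NormedAddCommGroup E] [NormedSpace ℝ E] [MeasurableSpace E]
    [BorelSpace E] [FiniteDimensional ℝ E] (μ : Measure E) [μ.IsAddHaarMeasure]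
    {f : E →ₗ[ℝ] E} (hf : LinearMap.det f ≠ 0) (F : E → ℂ) :
    Transfers μ μ (fun a => ((|LinearMap.det f| : ℝ) : ℂ) * F (f a)) F :=
  of_scaling f.continuous_of_finiteDimensional.measurable (abs_pos.mpr hf)
    (by rw [Measure.map_linearMap_addHaar_eq_smul_addHaar μ hf, abs_inv]) F

/-- Fubini: fiberwise transfer over a common base. -/
theorem prod [SFinite μ] [SFinite ν] [SFinite ρ] {G : A × B → ℂ} {F : A × C → ℂ}
    (hG : AEStronglyMeasurable G (μ.prod ν))
    (h : ∀ a, Transfers ν ρ (fun b => G (a, b)) (fun c => F (a, c))) :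
    Transfers (μ.prod ν) (μ.prod ρ) G F := fun hF => by
  have h1 := ((integrable_prod_iff hF.aestronglyMeasurable).1 hF).1
  have hn : (fun a => ∫ b, ‖G (a, b)‖ ∂ν) =ᵐ[μ] fun a => ∫ c, ‖F (a, c)‖ ∂ρ := by
    filter_upwards [h1] with a ha using (h a ha).2.1
  have hi : (fun a => ∫ b, G (a, b) ∂ν) =ᵐ[μ] fun a => ∫ c, F (a, c) ∂ρ := by
    filter_upwards [h1] with a ha using (h a ha).2.2
  have hGi : Integrable G (μ.prod ν) := by
    refine (integrable_prod_iff hG).2 ⟨?_, ?_⟩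
    · filter_upwards [h1] with a ha using (h a ha).1
    · exact hF.integral_norm_prod_left.congr hn.symm
  refine ⟨hGi, ?_, ?_⟩
  · rw [integral_prod _ hGi.norm, integral_prod _ hF.norm]
    exact integral_congr_ae hn
  · rw [integral_prod _ hGi, integral_prod _ hF]
    exact integral_congr_ae hi

theorem of_zero : Transfers μ ν (fun _ => 0) (fun _ => 0) := fun _ => by simp

theorem swap [SFinite μ] [SFinite ν] (F : A × B → ℂ) :
    Transfers (ν.prod μ) (μ.prod ν) (fun x => F x.swap) F :=
  of_measurePreserving Measure.measurePreserving_swap F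

end Transfers

section Gaussian

variable {κ : Type*} [Fintype κ]

theorem integrable_exp_neg_sum_sq :
    Integrable (fun l : κ → ℝ => Real.exp (-∑ i, l i ^ 2)) := by
  have h := Integrable.fintype_prod (ι := κ) (𝕜 := ℝ) (f := fun _ (x : ℝ) => Real.exp (-x ^ 2))
    (μ := fun _ => volume) (fun _ => by simpa using integrable_exp_neg_mul_sq one_pos)
  simpa [← Real.exp_sum, volume_pi] using h

theorem integral_exp_neg_sum_sq :
    ∫ l : κ → ℝ, Real.exp (-∑ i, l i ^ 2) = Real.pi ^ ((Fintype.card κ : ℝ) / 2) := by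
  have h := integral_fintype_prod_volume_eq_prod (ι := κ) (fun _ (x : ℝ) => Real.exp (-x ^ 2))
  simp only [← Real.exp_sum, Finset.sum_neg_distrib] at h
  have hg := integral_gaussian 1
  simp only [neg_mul, one_mul, div_one] at hg
  rw [h, hg]
  rw [Finset.prod_const, Real.sqrt_eq_rpow, ← Real.rpow_natCast, ← Real.rpow_mul Real.pi_pos.le]
  congr 1
  simp
  ring

/-- The Jacobian of `(y, l) ↦ (t y, √t l)`. -/
theorem det_scale (t : ℝ) (ht : 0 < t) :
    LinearMap.det ((t • LinearMap.id : ℝ →ₗ[ℝ] ℝ).prodMap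
      (√t • LinearMap.id : (κ → ℝ) →ₗ[ℝ] (κ → ℝ))) = t ^ (1 + (Fintype.card κ : ℝ) / 2) := by
  rw [LinearMap.det_prodMap, LinearMap.det_smul, LinearMap.det_smul]
  simp only [LinearMap.det_id, Module.finrank_self, pow_one, mul_one,
    Module.finrank_fintype_fun_eq_card]
  rw [Real.rpow_add ht, Real.rpow_one, Real.sqrt_eq_rpow, ← Real.rpow_natCast,
    ← Real.rpow_mul ht.le]
  congr 2
  ring

/-- The integrand of `Γ(b)`, extended by zero to the real line. -/
noncomputable def gammaDensity (b : ℂ) (t : ℝ) : ℂ :=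
  if 0 < t then (t : ℂ) ^ (b - 1) * (Real.exp (-t) : ℂ) else 0

theorem gammaDensity_eq_indicator (b : ℂ) : gammaDensity b =
    (Set.Ioi (0 : ℝ)).indicator fun t => (Real.exp (-t) : ℂ) * (t : ℂ) ^ (b - 1) := by
  ext t
  simp [gammaDensity, Set.indicator_apply, mul_comm]

theorem integrable_gammaDensity {b : ℂ} (hb : 0 < b.re) : Integrable (gammaDensity b) := by
  rw [gammaDensity_eq_indicator, integrable_indicator_iff measurableSet_Ioi]
  exact Complex.GammaIntegral_convergent hb

theorem integral_gammaDensity {b : ℂ} (hb : 0 < b.re) :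
    ∫ t, gammaDensity b t = Complex.Gamma b := by
  rw [gammaDensity_eq_indicator, integral_indicator measurableSet_Ioi,
    Complex.Gamma_eq_integral hb, Complex.GammaIntegral]

/-- The integrand `y^{a-1} (1 + y + |l|²)^{-c}` on `y > 0`, `l ∈ ℝ^κ`, extended by zero. -/
noncomputable def radialDensity (a : ℂ) (c : ℝ) (x : ℝ × (κ → ℝ)) : ℂ :=
  if 0 < x.1 then (x.1 : ℂ) ^ (a - 1) * (((1 + x.1 + ∑ i, x.2 i ^ 2) ^ (-c) : ℝ) : ℂ) else 0

/-- Both parts follow from `Γ(c) r^{-c} = ∫ t^{c-1} e^{-tr} dt` and the substitution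
`(y, l) ↦ (t y, √t l)`, which separates the variables `t`, `y` and `l`. -/
theorem integrable_radialDensity_and_integral {a : ℂ} {c : ℝ} (ha : 0 < a.re)
    (hb : 0 < ((c : ℂ) - a - (Fintype.card κ : ℂ) / 2).re) :
    Integrable (radialDensity (κ := κ) a c) ∧
    ∫ x, radialDensity (κ := κ) a c x =
      ((Real.pi ^ ((Fintype.card κ : ℝ) / 2) : ℝ) : ℂ) * Complex.Gamma a *
        Complex.Gamma ((c : ℂ) - a - (Fintype.card κ : ℂ) / 2) / Complex.Gamma c := by
  set m : ℝ := (Fintype.card κ : ℝ) with hm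
  set b : ℂ := (c : ℂ) - a - (Fintype.card κ : ℂ) / 2 with hbdef
  have hm0 : 0 ≤ m := by positivity
  have hcb : (c : ℂ) - 1 = ((1 + m / 2 : ℝ) : ℂ) + (b - 1) + (a - 1) := by
    rw [hbdef, hm]; push_cast; ring
  have hc : 0 < c := by
    have h1 : b.re = c - a.re - m / 2 := by simp [hbdef, hm]
    linarith
  let K : ℝ × (ℝ × (κ → ℝ)) → ℂ := fun x =>
    gammaDensity b x.1 * (gammaDensity a x.2.1 * (Real.exp (-∑ i, x.2.2 i ^ 2) : ℂ))
  have hg := integrable_exp_neg_sum_sq (κ := κ)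
  have hK2 : Integrable fun x : ℝ × (κ → ℝ) =>
      gammaDensity a x.1 * (Real.exp (-∑ i, x.2 i ^ 2) : ℂ) :=
    (integrable_gammaDensity ha).mul_prod hg.ofReal
  have hK : Integrable K := (integrable_gammaDensity hb).mul_prod hK2
  have hKint : ∫ x, K x = Complex.Gamma b * (Complex.Gamma a * ((Real.pi ^ (m / 2) : ℝ) : ℂ)) := by
    rw [← integral_gammaDensity ha, ← integral_gammaDensity hb, ← integral_exp_neg_sum_sq,
      ← integral_complex_ofReal]
    rw [← integral_prod_mul]
    exact integral_prod_mul (gammaDensity b) fun x : ℝ × (κ → ℝ) =>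
      gammaDensity a x.1 * (Real.exp (-∑ i, x.2 i ^ 2) : ℂ)
  let G : ℝ × (ℝ × (κ → ℝ)) → ℂ := fun x =>
    if 0 < x.1 then if 0 < x.2.1 then
      (x.2.1 : ℂ) ^ (a - 1) *
        ((x.1 ^ (c - 1) * Real.exp (-((1 + x.2.1 + ∑ i, x.2.2 i ^ 2) * x.1)) : ℝ) : ℂ)
      else 0 else 0
  have hGm : Measurable G := by
    refine Measurable.ite (measurableSet_lt measurable_const measurable_fst) ?_ measurable_const
    refine Measurable.ite (measurableSet_lt measurable_const (by fun_prop)) ?_ measurable_const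
    fun_prop
  have hGK : Transfers volume volume G K := by
    refine Transfers.prod hGm.aestronglyMeasurable fun t => ?_
    by_cases ht : 0 < t
    · have hdet := det_scale (κ := κ) t ht
      have hpos : 0 < t ^ (1 + m / 2) := by positivity
      have key := Transfers.of_linearMap ((volume : Measure ℝ).prod (volume : Measure (κ → ℝ)))
        (f := (t • LinearMap.id : ℝ →ₗ[ℝ] ℝ).prodMap
          (√t • LinearMap.id : (κ → ℝ) →ₗ[ℝ] (κ → ℝ))) (by rw [hdet]; exact hpos.ne')
        (fun x => K (t, x))
      rw [hdet, abs_of_pos hpos] at key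
      suffices hfun : ∀ x : ℝ × (κ → ℝ), G (t, x) = ((t ^ (1 + m / 2) : ℝ) : ℂ) *
          K (t, ((t • LinearMap.id : ℝ →ₗ[ℝ] ℝ).prodMap
            (√t • LinearMap.id : (κ → ℝ) →ₗ[ℝ] (κ → ℝ))) x) by
        rw [funext hfun]
        exact key
      rintro ⟨y, l⟩
      simp only [G, K, gammaDensity, if_pos ht, LinearMap.prodMap_apply, LinearMap.smul_apply,
        LinearMap.id_apply, smul_eq_mul, Pi.smul_apply, mul_pos_iff_of_pos_left ht]
      split_ifs with hy
      · have e1 : ∑ i, (√t * l i) ^ 2 = t * ∑ i, l i ^ 2 := by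
          rw [Finset.mul_sum]
          exact Finset.sum_congr rfl fun i _ => by rw [mul_pow, Real.sq_sqrt ht.le]
        have e2 : Real.exp (-((1 + y + ∑ i, l i ^ 2) * t)) =
            Real.exp (-t) * Real.exp (-(t * y)) * Real.exp (-(t * ∑ i, l i ^ 2)) := by
          rw [← Real.exp_add, ← Real.exp_add]; congr 1; ring
        have e3 : ((t ^ (c - 1) : ℝ) : ℂ) =
            ((t ^ (1 + m / 2) : ℝ) : ℂ) * (t : ℂ) ^ (b - 1) * (t : ℂ) ^ (a - 1) := by
          have ht0 : (t : ℂ) ≠ 0 := by exact_mod_cast ht.ne'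
          rw [Complex.ofReal_cpow ht.le, Complex.ofReal_cpow ht.le, ← Complex.cpow_add _ _ ht0,
            ← Complex.cpow_add _ _ ht0, ← hcb]
          push_cast; rfl
        rw [e1, e2, Complex.ofReal_mul, e3, Complex.ofReal_mul t y,
          Complex.mul_cpow_ofReal_nonneg ht.le hy.le]
        push_cast
        ring
      · simp
    · simp only [G, K, gammaDensity, if_neg ht, zero_mul]
      exact Transfers.of_zero
  obtain ⟨hG, -, hGint⟩ := hGK hK
  -- Integrating over `t` first recovers the power of `1 + y + |l|²`.
  have hslice : ∀ x : ℝ × (κ → ℝ), ∫ t, G (t, x) = Complex.Gamma c * radialDensity a c x := by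
    rintro ⟨y, l⟩
    by_cases hy : 0 < y
    · have hr : 0 < 1 + y + ∑ i, l i ^ 2 := by positivity
      have h1 := Real.integral_rpow_mul_exp_neg_mul_Ioi hc hr
      have h2 : (fun t => G (t, (y, l))) = (Set.Ioi (0 : ℝ)).indicator fun t =>
          (y : ℂ) ^ (a - 1) *
            ((t ^ (c - 1) * Real.exp (-((1 + y + ∑ i, l i ^ 2) * t)) : ℝ) : ℂ) := by
        ext t; simp only [G, if_pos hy, Set.indicator_apply, Set.mem_Ioi]
      rw [h2, integral_indicator measurableSet_Ioi, integral_const_mul, integral_complex_ofReal,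
        h1, radialDensity, if_pos hy, Complex.Gamma_ofReal, one_div, Real.inv_rpow hr.le,
        Real.rpow_neg hr.le]
      push_cast
      ring
    · simp [G, radialDensity, hy]
  have hΓ : Complex.Gamma (c : ℂ) ≠ 0 := Complex.Gamma_ne_zero_of_re_pos (by simpa using hc)
  have hint := Integrable.integral_prod_right hG
  simp only [hslice] at hint
  refine ⟨by simpa [hΓ] using hint.const_mul (Complex.Gamma c)⁻¹, ?_⟩
  rw [hKint] at hGint
  have h3 := integral_prod_symm G hG
  simp only [hslice, integral_const_mul] at h3
  rw [eq_div_iff hΓ, mul_comm]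
  refine h3.symm.trans ?_
  rw [show Measure.prod volume volume = (volume : Measure (ℝ × (ℝ × (κ → ℝ)))) from rfl, hGint]
  ring

end Gaussian

/-! ### Pivots of symmetric matrices -/

/-- The Schur complement of the upper left entry. -/
noncomputable def pivotSchur {p : ℕ} (Y : Matrix (Fin (p + 1)) (Fin (p + 1)) ℝ) :
    Matrix (Fin p) (Fin p) ℝ :=
  Matrix.of fun i j => Y i.succ j.succ - Y i.succ 0 * Y 0 j.succ / Y 0 0

theorem det_eq_mul_det_pivotSchur {p : ℕ} (Y : Matrix (Fin (p + 1)) (Fin (p + 1)) ℝ)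
    (hY : Y 0 0 ≠ 0) : Y.det = Y 0 0 * (pivotSchur Y).det := by
  -- `Z` is `Y` with its first column cleared below the pivot.
  let Z : Matrix (Fin (p + 1)) (Fin (p + 1)) ℝ :=
    Matrix.of (Fin.cons (Y 0) fun i j => Y i.succ j - Y i.succ 0 / Y 0 0 * Y 0 j)
  have h1 : Y.det = Z.det := by
    refine det_eq_of_forall_row_eq_smul_add_const
      (Fin.cons 0 fun i => Y i.succ 0 / Y 0 0) 0 rfl fun i j => ?_
    refine Fin.cases ?_ (fun i => ?_) i <;> simp [Z]
  rw [h1, det_succ_column_zero, Fin.sum_univ_succ]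
  have h2 : Z.submatrix (Fin.succAbove 0) Fin.succ = pivotSchur Y := by
    ext i j
    simp [Z, pivotSchur]
    ring
  simp only [h2]
  simp [Z, hY]

theorem leadingMinor_zero {p : ℕ} (Y : Matrix (Fin (p + 1)) (Fin (p + 1)) ℝ) :
    leadingMinor Y 0 = Y 0 0 := by
  unfold leadingMinor
  exact det_fin_one _

theorem leadingMinor_succ {p : ℕ} (Y : Matrix (Fin (p + 1)) (Fin (p + 1)) ℝ) (hY : Y 0 0 ≠ 0)
    (j : Fin p) : leadingMinor Y j.succ = Y 0 0 * leadingMinor (pivotSchur Y) j := by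
  unfold leadingMinor
  exact det_eq_mul_det_pivotSchur _ hY

theorem posDef_iff_pivotSchur {p : ℕ} {Y : Matrix (Fin (p + 1)) (Fin (p + 1)) ℝ}
    (hY : Y.IsHermitian) : Y.PosDef ↔ 0 < Y 0 0 ∧ (pivotSchur Y).PosDef := by
  have hsym : ∀ i j, Y i j = Y j i := fun i j => by simpa using (hY.apply i j).symm
  have hS : (pivotSchur Y).IsHermitian := by
    ext i j
    simp only [conjTranspose_apply, star_trivial, pivotSchur, of_apply]
    rw [hsym j.succ i.succ, hsym j.succ 0, hsym 0 i.succ]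
    ring
  have key : Y 0 0 ≠ 0 → ∀ (t : ℝ) (w : Fin p → ℝ),
      star (Fin.cons t w : Fin (p + 1) → ℝ) ⬝ᵥ (Y *ᵥ Fin.cons t w) =
        Y 0 0 * (t + (∑ i, Y 0 i.succ * w i) / Y 0 0) ^ 2 +
          star w ⬝ᵥ (pivotSchur Y *ᵥ w) := by
    intro h0 t w
    have e1 : ∑ i : Fin p, w i * ∑ j, (Y i.succ j.succ - Y i.succ 0 * Y 0 j.succ / Y 0 0) * w j =
        ∑ i : Fin p, w i * ∑ j, Y i.succ j.succ * w j -
          (∑ i, Y 0 i.succ * w i) * (∑ i, Y 0 i.succ * w i) / Y 0 0 := by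
      rw [Finset.sum_mul, Finset.sum_div, ← Finset.sum_sub_distrib]
      refine Finset.sum_congr rfl fun i _ => ?_
      rw [hsym i.succ 0, Finset.mul_sum, Finset.mul_sum, Finset.mul_sum, Finset.sum_div,
        ← Finset.sum_sub_distrib]
      exact Finset.sum_congr rfl fun j _ => by ring
    have e2 : ∑ i : Fin p, w i * (Y i.succ 0 * t) = t * ∑ i, Y 0 i.succ * w i := by
      rw [Finset.mul_sum]
      exact Finset.sum_congr rfl fun i _ => by rw [hsym i.succ 0]; ring
    simp only [star_trivial, dotProduct, mulVec, Fin.sum_univ_succ, Fin.cons_zero, Fin.cons_succ,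
      pivotSchur, of_apply]
    rw [e1]
    simp only [mul_add, Finset.sum_add_distrib]
    rw [e2]
    field_simp
    ring
  constructor
  · intro h
    have h0 : 0 < Y 0 0 := h.diag_pos
    refine ⟨h0, .of_dotProduct_mulVec_pos hS fun {w} hw => ?_⟩
    -- The first coordinate is chosen so that the square in `key` vanishes.
    have hne : (Fin.cons (-((∑ i, Y 0 i.succ * w i) / Y 0 0)) w : Fin (p + 1) → ℝ) ≠ 0 := by
      intro h
      exact hw (funext fun i => by simpa using congrFun h i.succ)
    have := h.dotProduct_mulVec_pos hne
    rw [key h0.ne'] at this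
    simpa using this
  · rintro ⟨h0, h⟩
    refine .of_dotProduct_mulVec_pos hY fun {v} hv => ?_
    obtain ⟨t, w, rfl⟩ : ∃ t w, v = Fin.cons t w := ⟨v 0, Fin.tail v, (Fin.cons_self_tail v).symm⟩
    rw [key h0.ne']
    by_cases hw : w = 0
    · subst hw
      have ht : t ≠ 0 := by
        rintro rfl
        exact hv (funext fun i => by refine Fin.cases ?_ (fun i => ?_) i <;> simp)
      simp
      positivity
    · have := h.dotProduct_mulVec_pos hw
      positivity

/-- The power function `∏ d_j ^ E_j` of the cone of positive definite matrices, where `d_j` are the pivots of `Y`, i.e. `Y = U diag(d) Uᵗ` with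
`U` lower unitriangular; zero unless all pivots are positive. -/
noncomputable def pivotPower : {p : ℕ} → (Fin p → ℂ) → Matrix (Fin p) (Fin p) ℝ → ℂ
  | 0, _, _ => 1
  | _ + 1, E, Y => if 0 < Y 0 0 then
      ((Y 0 0 : ℝ) : ℂ) ^ E 0 * pivotPower (fun j => E j.succ) (pivotSchur Y) else 0

theorem measurable_matrix_apply {p q : ℕ} (i : Fin p) (j : Fin q) :
    Measurable fun Y : Matrix (Fin p) (Fin q) ℝ => Y i j :=
  (continuous_id.matrix_elem i j).measurable

theorem measurable_matrix_of {A : Type*} [MeasurableSpace A] {p q : ℕ}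
    {f : A → Matrix (Fin p) (Fin q) ℝ} (hf : ∀ i j, Measurable fun a => f a i j) :
    Measurable f :=
  measurable_pi_lambda f fun i => measurable_pi_lambda (fun a => f a i) fun j => hf i j

theorem measurable_det {A n : Type*} [MeasurableSpace A] [Fintype n] [DecidableEq n]
    {f : A → Matrix n n ℝ} (hf : ∀ i j, Measurable fun a => f a i j) :
    Measurable fun a => (f a).det := by
  simp only [det_apply]
  exact Finset.measurable_sum _ fun σ _ =>
    (Finset.measurable_prod _ fun k _ => hf _ _).const_smul _

theorem measurable_inv_apply {A n : Type*} [MeasurableSpace A] [Fintype n] [DecidableEq n]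
    {f : A → Matrix n n ℝ} (hf : ∀ i j, Measurable fun a => f a i j) (i j : n) :
    Measurable fun a => (f a)⁻¹ i j := by
  simp only [inv_def, Ring.inverse_eq_inv', Matrix.smul_apply, smul_eq_mul, adjugate_apply]
  refine (measurable_det hf).inv.mul (measurable_det fun k l => ?_)
  simp only [updateRow_apply]
  split_ifs
  · exact measurable_const
  · exact hf k l

theorem measurable_pivotPower : ∀ {p : ℕ} (E : Fin p → ℂ), Measurable (pivotPower E)
  | 0, _ => measurable_const
  | p + 1, E => by
    have h0 := measurable_matrix_apply (0 : Fin (p + 1)) (0 : Fin (p + 1))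
    refine Measurable.ite (measurableSet_lt measurable_const h0) ?_ measurable_const
    refine Measurable.mul (by fun_prop) ((measurable_pivotPower _).comp ?_)
    refine measurable_matrix_of fun i j => ?_
    have h1 := measurable_matrix_apply i.succ j.succ
    have h2 := measurable_matrix_apply i.succ (0 : Fin (p + 1))
    have h3 := measurable_matrix_apply (0 : Fin (p + 1)) j.succ
    simp only [pivotSchur, of_apply]
    fun_prop

theorem pivotPower_eq_zero : ∀ {p : ℕ} (E : Fin p → ℂ) {Y : Matrix (Fin p) (Fin p) ℝ},
    Y.IsHermitian → ¬ Y.PosDef → pivotPower E Y = 0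
  | 0, _, Y, hY, h => by
    refine absurd (.of_dotProduct_mulVec_pos hY fun {v} hv => ?_) h
    exact absurd (Subsingleton.elim v 0) hv
  | p + 1, E, Y, hY, h => by
    rw [posDef_iff_pivotSchur hY] at h
    rw [pivotPower]
    split_ifs with h0
    · have hS : (pivotSchur Y).IsHermitian := by
        ext i j
        have hsym : ∀ i j, Y i j = Y j i := fun i j => by simpa using (hY.apply i j).symm
        simp only [conjTranspose_apply, star_trivial, pivotSchur, of_apply]
        rw [hsym j.succ i.succ, hsym j.succ 0, hsym 0 i.succ]
        ring
      rw [pivotPower_eq_zero _ hS fun h' => h ⟨h0, h'⟩, mul_zero]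
    · rfl

theorem leadingMinor_pos {p : ℕ} {Y : Matrix (Fin p) (Fin p) ℝ} (hY : Y.PosDef) (j : Fin p) :
    0 < leadingMinor Y j :=
  (hY.submatrix (Fin.castLE_injective _)).det_pos

theorem prod_cpow_const {ι : Type*} {z : ℂ} (hz : z ≠ 0) (s : Finset ι) (e : ι → ℂ) :
    ∏ i ∈ s, z ^ e i = z ^ ∑ i ∈ s, e i := by
  classical
  induction s using Finset.induction_on with
  | empty => simp
  | insert i s hi ih => rw [Finset.prod_insert hi, Finset.sum_insert hi, ih, Complex.cpow_add _ _ hz]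

/-- The leading minors are the partial products of the pivots, so the exponent of a pivot is the sum
of the exponents of the leading minors from its index on. -/
theorem prod_leadingMinor_cpow : ∀ {p : ℕ} (e : Fin p → ℂ) {Y : Matrix (Fin p) (Fin p) ℝ},
    Y.PosDef → ∏ j, ((leadingMinor Y j : ℝ) : ℂ) ^ e j =
      pivotPower (fun k => ∑ j, if k ≤ j then e j else 0) Y
  | 0, _, _, _ => by simp [pivotPower]
  | p + 1, e, Y, hY => by
    obtain ⟨h0, hS⟩ := (posDef_iff_pivotSchur hY.1).1 hY
    have hne : ((Y 0 0 : ℝ) : ℂ) ≠ 0 := by exact_mod_cast h0.ne'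
    rw [pivotPower, if_pos h0, Fin.prod_univ_succ, leadingMinor_zero]
    have h1 : ∀ j : Fin p, ((leadingMinor Y j.succ : ℝ) : ℂ) ^ e j.succ =
        ((Y 0 0 : ℝ) : ℂ) ^ e j.succ *
          ((leadingMinor (pivotSchur Y) j : ℝ) : ℂ) ^ e j.succ := fun j => by
      rw [leadingMinor_succ Y h0.ne', Complex.ofReal_mul,
        Complex.mul_cpow_ofReal_nonneg h0.le (leadingMinor_pos hS j).le]
    simp only [h1, Finset.prod_mul_distrib]
    rw [prod_leadingMinor_cpow (fun j => e j.succ) hS, ← mul_assoc,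
      prod_cpow_const hne, ← Complex.cpow_add _ _ hne]
    simp [Fin.sum_univ_succ]

theorem pivotPower_mul_det_cpow : ∀ {p : ℕ} (E : Fin p → ℂ) (c : ℂ)
    {Y : Matrix (Fin p) (Fin p) ℝ}, Y.PosDef →
    pivotPower E Y * ((Y.det : ℝ) : ℂ) ^ c = pivotPower (fun k => E k + c) Y
  | 0, _, _, _, _ => by simp [pivotPower]
  | p + 1, E, c, Y, hY => by
    obtain ⟨h0, hS⟩ := (posDef_iff_pivotSchur hY.1).1 hY
    have hne : ((Y 0 0 : ℝ) : ℂ) ≠ 0 := by exact_mod_cast h0.ne'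
    rw [pivotPower, if_pos h0, pivotPower, if_pos h0, det_eq_mul_det_pivotSchur Y h0.ne',
      ← pivotPower_mul_det_cpow (fun j => E j.succ) c hS, Complex.ofReal_mul,
      Complex.mul_cpow_ofReal_nonneg h0.le hS.det_pos.le, Complex.cpow_add _ _ hne]
    ring

section Gram

variable {κ : Type*} [Fintype κ]

/-- The symmetric matrix `(X + Xᵗ)/2 - L Lᵗ`. -/
noncomputable def symGram {n : Type*} (X : Matrix n n ℝ) (L : Matrix n κ ℝ) : Matrix n n ℝ :=
  (1 / 2 : ℝ) • (X + Xᵀ) - L * Lᵀ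

theorem symGram_apply {n : Type*} (X : Matrix n n ℝ) (L : Matrix n κ ℝ) (i j : n) :
    symGram X L i j = (X i j + X j i) / 2 - L i ⬝ᵥ L j := by
  simp [symGram, mul_apply, dotProduct]
  ring

theorem isHermitian_symGram {n : Type*} (X : Matrix n n ℝ) (L : Matrix n κ ℝ) :
    (symGram X L).IsHermitian := by
  ext i j
  simp only [conjTranspose_apply, star_trivial, symGram_apply]
  rw [dotProduct_comm (L j) (L i)]
  ring

variable [DecidableEq κ]

/-- For `r² = 1 + σ² + |l|²`, a square root `B`, in the sense `Bᵗ B = Q`, of the quadratic form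
`Q = |λ|² + ((u + v)/2 - λ · l)²/σ² - u v/r²` in the variables `(λ, u, v)`. -/
noncomputable def gramRoot (σ r : ℝ) (l : κ → ℝ) : Matrix (κ ⊕ Fin 2) (κ ⊕ Fin 2) ℝ :=
  fromBlocks 1 (of fun i _ => -(1 / (r * (r + 1)) / 2 * l i))
    (of ![fun i => -(l i / σ), fun _ => 0])
    !![(1 / σ - 1 / (r * (r + 1)) * σ) / 2, (1 / σ - 1 / (r * (r + 1)) * σ) / 2;
      1 / (2 * r), -(1 / (2 * r))]

theorem abs_det_gramRoot {σ r : ℝ} (hσ : 0 < σ) (hr : 0 < r) {l : κ → ℝ}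
    (h : r ^ 2 = 1 + (σ ^ 2 + l ⬝ᵥ l)) :
    |(gramRoot σ r l).det| = 1 / (2 * σ * r ^ 2) := by
  rw [gramRoot, det_fromBlocks_one₁₁, det_fin_two]
  have hc : ∀ j, (of ![fun i => -(l i / σ), fun _ => 0] * of fun i (_ : Fin 2) =>
      -(1 / (r * (r + 1)) / 2 * l i) : Matrix (Fin 2) (Fin 2) ℝ) 0 j =
      1 / (r * (r + 1)) / 2 / σ * (l ⬝ᵥ l) := by
    intro j
    simp only [mul_apply, of_apply, cons_val_zero, dotProduct, Finset.mul_sum]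
    exact Finset.sum_congr rfl fun i _ => by ring
  have hc1 : ∀ j, (of ![fun i => -(l i / σ), fun _ => 0] * of fun i (_ : Fin 2) =>
      -(1 / (r * (r + 1)) / 2 * l i) : Matrix (Fin 2) (Fin 2) ℝ) 1 j = 0 := by
    intro j
    simp [mul_apply]
  have hll : l ⬝ᵥ l = r ^ 2 - 1 - σ ^ 2 := by rw [h]; ring
  rw [Matrix.sub_apply, Matrix.sub_apply, Matrix.sub_apply, Matrix.sub_apply, hc, hc, hc1, hc1,
    hll, ← abs_of_pos (show 0 < 1 / (2 * σ * r ^ 2) by positivity), ← abs_neg]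
  congr 1
  simp only [of_apply, cons_val', cons_val_zero, cons_val_one, cons_val_fin_one]
  field_simp
  ring

theorem gramRoot_mulVec_dotProduct {σ r : ℝ} (hσ : 0 < σ) (hr : 0 < r) {l : κ → ℝ}
    (h : r ^ 2 = 1 + (σ ^ 2 + l ⬝ᵥ l)) (a b : κ ⊕ Fin 2 → ℝ) :
    (gramRoot σ r l *ᵥ a) ⬝ᵥ (gramRoot σ r l *ᵥ b) =
      (a ∘ Sum.inl) ⬝ᵥ (b ∘ Sum.inl) +
      ((a (Sum.inr 0) + a (Sum.inr 1)) / 2 - (a ∘ Sum.inl) ⬝ᵥ l) *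
        ((b (Sum.inr 0) + b (Sum.inr 1)) / 2 - (b ∘ Sum.inl) ⬝ᵥ l) / σ ^ 2 -
      (a (Sum.inr 0) * b (Sum.inr 1) + a (Sum.inr 1) * b (Sum.inr 0)) / (2 * r ^ 2) := by
  have hB : ∀ a : κ ⊕ Fin 2 → ℝ, gramRoot σ r l *ᵥ a = Sum.elim
      ((a ∘ Sum.inl) - (1 / (r * (r + 1)) * ((a (Sum.inr 0) + a (Sum.inr 1)) / 2)) • l)
      ![((a (Sum.inr 0) + a (Sum.inr 1)) / 2 - (a ∘ Sum.inl) ⬝ᵥ l) / σ -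
          1 / (r * (r + 1)) * σ * ((a (Sum.inr 0) + a (Sum.inr 1)) / 2),
        (a (Sum.inr 0) - a (Sum.inr 1)) / (2 * r)] := by
    intro a
    rw [gramRoot, fromBlocks_mulVec]
    congr 1
    · funext i
      simp [mulVec, dotProduct, Fin.sum_univ_two]
      ring
    · have h1 : ∑ i, l i / σ * a (Sum.inl i) = (∑ i, a (Sum.inl i) * l i) / σ := by
        rw [Finset.sum_div]
        exact Finset.sum_congr rfl fun i _ => by ring
      funext i
      fin_cases i
      · simp [dotProduct, Fin.sum_univ_two, h1]
        ring
      · simp [dotProduct, Fin.sum_univ_two]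
        ring
  rw [hB a, hB b, sumElim_dotProduct_sumElim]
  simp only [sub_dotProduct, dotProduct_sub, smul_dotProduct, dotProduct_smul, smul_eq_mul]
  rw [dotProduct_comm l (b ∘ Sum.inl), show l ⬝ᵥ l = r ^ 2 - 1 - σ ^ 2 by rw [h]; ring]
  generalize (a ∘ Sum.inl) ⬝ᵥ l = al
  generalize (b ∘ Sum.inl) ⬝ᵥ l = bl
  generalize (a ∘ Sum.inl) ⬝ᵥ (b ∘ Sum.inl) = ab
  simp only [dotProduct, Fin.sum_univ_two, cons_val_zero, cons_val_one, cons_val_fin_one]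
  field_simp
  ring

end Gram

/-! ### The integral over the tube domain -/

section Split

theorem measurePreserving_prodProdProdComm {A B C D : Type*} [MeasureSpace A] [MeasureSpace B]
    [MeasureSpace C] [MeasureSpace D] [SigmaFinite (volume : Measure A)]
    [SigmaFinite (volume : Measure B)] [SigmaFinite (volume : Measure C)]
    [SigmaFinite (volume : Measure D)] :
    MeasurePreserving (fun x : (A × B) × (C × D) => ((x.1.1, x.2.1), (x.1.2, x.2.2))) := by
  have h1 : MeasurePreserving (fun x : B × (C × D) => (x.2.1, (x.1, x.2.2))) :=
    volume_preserving_prodAssoc.comp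
      ((Measure.measurePreserving_swap.prod (MeasurePreserving.id volume)).comp
        (volume_preserving_prodAssoc (α₁ := B) (β₁ := C) (γ₁ := D)).symm)
  exact (volume_preserving_prodAssoc (α₁ := A) (β₁ := C) (γ₁ := B × D)).symm.comp
    (((MeasurePreserving.id volume).prod h1).comp
      (volume_preserving_prodAssoc (α₁ := A) (β₁ := B) (γ₁ := C × D)))

theorem measurePreserving_headTail (p : ℕ) (A : Type*) [MeasureSpace A]
    [SigmaFinite (volume : Measure A)] :
    MeasurePreserving (fun f : Fin (p + 1) → A => (f 0, fun i : Fin p => f i.succ)) :=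
  volume_preserving_piFinSuccAbove (fun _ => A) 0

/-- Splitting off the first row and the first column of a square matrix. -/
theorem measurePreserving_splitSquare (p : ℕ) :
    MeasurePreserving (fun X : Fin (p + 1) → Fin (p + 1) → ℝ =>
      ((X 0 0, fun j : Fin p => X 0 j.succ),
        ((fun i : Fin p => X i.succ 0), fun i j : Fin p => X i.succ j.succ))) := by
  have h1 := measurePreserving_headTail p (Fin (p + 1) → ℝ)
  have h2 := measurePreserving_headTail p ℝ
  have h3 := (volume_measurePreserving_arrowProdEquivProdArrow ℝ (Fin p → ℝ) (Fin p)).comp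
    (volume_preserving_pi fun _ : Fin p => h2)
  exact (h2.prod h3).comp h1

theorem measurePreserving_joinRows (p : ℕ) (κ : Type*) [Fintype κ] :
    MeasurePreserving (fun x : (Fin p → κ → ℝ) × ((Fin p → ℝ) × (Fin p → ℝ)) =>
      fun i => (Sum.elim (x.1 i) ![x.2.1 i, x.2.2 i] : κ ⊕ Fin 2 → ℝ)) := by
  have h1 := (volume_preserving_pi fun _ : Fin p => (volume_preserving_finTwoArrow ℝ).symm).comp
    (volume_measurePreserving_arrowProdEquivProdArrow ℝ ℝ (Fin p)).symm
  have h2 := (volume_preserving_pi fun _ : Fin p =>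
      (volume_measurePreserving_sumPiEquivProdPi (fun _ : κ ⊕ Fin 2 => ℝ)).symm).comp
    (volume_measurePreserving_arrowProdEquivProdArrow (κ → ℝ) (Fin 2 → ℝ) (Fin p)).symm
  have h3 := h2.comp ((MeasurePreserving.id volume).prod h1)
  suffices hfun : (fun x : (Fin p → κ → ℝ) × ((Fin p → ℝ) × (Fin p → ℝ)) =>
      fun i => (Sum.elim (x.1 i) ![x.2.1 i, x.2.2 i] : κ ⊕ Fin 2 → ℝ)) =
      ((fun a i => (MeasurableEquiv.sumPiEquivProdPi fun _ : κ ⊕ Fin 2 => ℝ).symm (a i)) ∘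
        (MeasurableEquiv.arrowProdEquivProdArrow (κ → ℝ) (Fin 2 → ℝ) (Fin p)).symm) ∘
      Prod.map id ((fun a i => MeasurableEquiv.finTwoArrow.symm (a i)) ∘
        (MeasurableEquiv.arrowProdEquivProdArrow ℝ ℝ (Fin p)).symm) by
    rw [hfun]
    exact h3
  funext x i k
  rcases k with k | k
  · rfl
  · fin_cases k <;> rfl

/-- Splitting off the first row of `L`, and the first row and column of `X`; the remaining rows
of `L` are extended by the first row and column of `X`. -/
def splitFirst (p : ℕ) (κ : Type*)
    (x : (Fin (p + 1) → κ → ℝ) × (Fin (p + 1) → Fin (p + 1) → ℝ)) :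
    (ℝ × (κ → ℝ)) × ((Fin p → κ ⊕ Fin 2 → ℝ) × (Fin p → Fin p → ℝ)) :=
  ((x.2 0 0, x.1 0), (fun i => Sum.elim (x.1 i.succ) ![x.2 0 i.succ, x.2 i.succ 0],
    fun i j => x.2 i.succ j.succ))

theorem measurePreserving_splitFirst (p : ℕ) (κ : Type*) [Fintype κ] :
    MeasurePreserving (splitFirst p κ) := by
  have h1 := (measurePreserving_headTail p (κ → ℝ)).prod
    (volume_preserving_prodAssoc.comp (measurePreserving_splitSquare p))
  have h2 := (measurePreserving_prodProdProdComm (A := κ → ℝ) (B := Fin p → κ → ℝ) (C := ℝ)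
    (D := (Fin p → ℝ) × ((Fin p → ℝ) × (Fin p → Fin p → ℝ)))).comp h1
  have h3 := (measurePreserving_joinRows p κ).prod
    (MeasurePreserving.id (volume : Measure (Fin p → Fin p → ℝ)))
  have h4 := (volume_preserving_prodAssoc (α₁ := Fin p → κ → ℝ)
      (β₁ := (Fin p → ℝ) × (Fin p → ℝ)) (γ₁ := Fin p → Fin p → ℝ)).symm.comp
    ((MeasurePreserving.id (volume : Measure (Fin p → κ → ℝ))).prod
      (volume_preserving_prodAssoc (α₁ := Fin p → ℝ) (β₁ := Fin p → ℝ)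
        (γ₁ := Fin p → Fin p → ℝ)).symm)
  exact ((Measure.measurePreserving_swap (μ := (volume : Measure (κ → ℝ)))
    (ν := (volume : Measure ℝ))).prod (h3.comp h4)).comp h2

end Split

section Tube

instance isAddHaarMeasure_volume_pi_pi (ι κ : Type*) [Fintype ι] [Fintype κ] :
    (volume : Measure (ι → κ → ℝ)).IsAddHaarMeasure :=
  Measure.pi.isAddHaarMeasure _

variable {κ : Type*} [Fintype κ]

/-- The integrand over the pairs `(L, X)`: a power function of `(X + Xᵗ)/2 - L Lᵗ`, restricted to
the set where this matrix is positive definite, times `|det(1 + X)|^{-α}`. -/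
noncomputable def tubeDensity {p : ℕ} (E : Fin p → ℂ) (α : ℝ)
    (x : (Fin p → κ → ℝ) × (Fin p → Fin p → ℝ)) : ℂ :=
  pivotPower E (symGram (of x.2) (of x.1)) * ((|(1 + of x.2).det| ^ (-α) : ℝ) : ℂ)

theorem measurable_tubeDensity {p : ℕ} (E : Fin p → ℂ) (α : ℝ) :
    Measurable (tubeDensity (κ := κ) E α) := by
  have h1 : Measurable fun x : (Fin p → κ → ℝ) × (Fin p → Fin p → ℝ) =>
      symGram (of x.2) (of x.1) := by
    refine measurable_matrix_of fun i j => ?_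
    simp only [symGram_apply, of_apply, dotProduct]
    fun_prop
  have h2 : Measurable fun x : (Fin p → κ → ℝ) × (Fin p → Fin p → ℝ) => (1 + of x.2).det :=
    measurable_det fun i j => by simp only [Matrix.add_apply, of_apply]; fun_prop
  exact ((measurable_pivotPower E).comp h1).mul
    (Complex.measurable_ofReal.comp ((measurable_norm.comp h2).pow_const _))

variable [DecidableEq κ]

/-- `tubeDensity` after removal of the first pivot, in the coordinates of `splitFirst`: here
`x.1 = (x, l)` are the upper left entry of `X` and the first row of `L`. -/
noncomputable def tubeDensitySplit {p : ℕ} (E : Fin (p + 1) → ℂ) (α : ℝ)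
    (x : (ℝ × (κ → ℝ)) × ((Fin p → κ ⊕ Fin 2 → ℝ) × (Fin p → Fin p → ℝ))) : ℂ :=
  if 0 < x.1.1 - x.1.2 ⬝ᵥ x.1.2 then
    (((x.1.1 - x.1.2 ⬝ᵥ x.1.2 : ℝ) : ℂ) ^ E 0 * (((1 + x.1.1) ^ (-α) : ℝ) : ℂ)) *
      tubeDensity (fun j => E j.succ) α
        (fun i => gramRoot (√(x.1.1 - x.1.2 ⬝ᵥ x.1.2)) (√(1 + x.1.1)) x.1.2 *ᵥ x.2.1 i,
          fun i j => x.2.2 i j - x.2.1 i (Sum.inr 1) * x.2.1 j (Sum.inr 0) / (1 + x.1.1))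
    else 0

/-- Removing the first pivot `y = x - |l|²` of `(X + Xᵗ)/2 - L Lᵗ` leaves the Schur complement
`(X' + X'ᵗ)/2 - L' L'ᵗ - w wᵗ/y`, where `w = (u + v)/2 - L' l`. After `X'` is replaced by
the Schur complement `X' - v uᵗ/(1 + x)` of `1 + X`, what is subtracted is the Gram matrix of the
rows `(L'ᵢ, uᵢ, vᵢ)` with respect to the quadratic form whose root is `gramRoot`, so that it is
again of the form `(X + Xᵗ)/2 - L Lᵗ`, with two more columns in `L`. -/
theorem tubeDensity_eq_split {p : ℕ} (E : Fin (p + 1) → ℂ) (α : ℝ)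
    (x : (Fin (p + 1) → κ → ℝ) × (Fin (p + 1) → Fin (p + 1) → ℝ)) :
    tubeDensity E α x = tubeDensitySplit E α (splitFirst p κ x) := by
  obtain ⟨L, X⟩ := x
  have h00 : symGram (of X) (of L) 0 0 = X 0 0 - L 0 ⬝ᵥ L 0 := by
    rw [symGram_apply]; simp only [of_apply]
    change (X 0 0 + X 0 0) / 2 - L 0 ⬝ᵥ L 0 = _
    ring
  rw [tubeDensity, pivotPower, h00]
  by_cases hy : 0 < X 0 0 - L 0 ⬝ᵥ L 0
  · rw [if_pos hy]
    refine Eq.trans ?_ (if_pos hy).symm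
    simp only [splitFirst]
    have hl : 0 ≤ L 0 ⬝ᵥ L 0 := Finset.sum_nonneg fun i _ => mul_self_nonneg _
    have hx : 0 < 1 + X 0 0 := by linarith
    have hdet : (1 + of X).det = (1 + X 0 0) * (1 + of fun i j : Fin p =>
        X i.succ j.succ - X i.succ 0 * X 0 j.succ / (1 + X 0 0)).det := by
      have e0 : (1 + of X) 0 0 = 1 + X 0 0 := by simp
      rw [det_eq_mul_det_pivotSchur _ (by rw [e0]; exact hx.ne'), e0]
      congr 2
      ext i j
      simp [pivotSchur, one_apply, (Fin.succ_ne_zero _).symm]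
      ring
    -- The mixed term `-(uᵢ vⱼ + vᵢ uⱼ)/(2 (1 + x))` of the form compensates for the change of `X'`.
    have hschur : pivotSchur (symGram (of X) (of L)) = symGram
        (of fun i j : Fin p => X i.succ j.succ - X i.succ 0 * X 0 j.succ / (1 + X 0 0))
        (of fun i : Fin p => gramRoot (√(X 0 0 - L 0 ⬝ᵥ L 0)) (√(1 + X 0 0)) (L 0) *ᵥ
          Sum.elim (L i.succ) ![X 0 i.succ, X i.succ 0]) := by
      ext i j
      rw [symGram_apply]
      have hrow : ∀ i : Fin p, (of fun i : Fin p =>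
          gramRoot (√(X 0 0 - L 0 ⬝ᵥ L 0)) (√(1 + X 0 0)) (L 0) *ᵥ
          Sum.elim (L i.succ) ![X 0 i.succ, X i.succ 0]) i =
          gramRoot (√(X 0 0 - L 0 ⬝ᵥ L 0)) (√(1 + X 0 0)) (L 0) *ᵥ
          Sum.elim (L i.succ) ![X 0 i.succ, X i.succ 0] := fun _ => rfl
      rw [hrow, hrow, gramRoot_mulVec_dotProduct (Real.sqrt_pos.2 hy) (Real.sqrt_pos.2 hx)
        (by rw [Real.sq_sqrt hx.le, Real.sq_sqrt hy.le]; ring),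
        Real.sq_sqrt hx.le, Real.sq_sqrt hy.le]
      simp only [pivotSchur, of_apply, h00, symGram_apply, Sum.elim_inr, cons_val_zero,
        cons_val_one, Sum.elim_comp_inl, cons_val_fin_one]
      have hrowL : ∀ i, of L i = L i := fun _ => rfl
      simp only [hrowL]
      rw [dotProduct_comm (L 0) (L j.succ)]
      field_simp
      ring
    rw [hschur, hdet, abs_mul, abs_of_pos hx, Real.mul_rpow hx.le (abs_nonneg _)]
    simp only [Sum.elim_inr, cons_val_zero, cons_val_one, cons_val_fin_one, tubeDensity, Complex.ofReal_mul]
    ac_rfl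
  · rw [if_neg hy, zero_mul]
    exact (if_neg hy).symm

theorem measurable_gramRoot_apply (i k : κ ⊕ Fin 2) : Measurable fun x : ℝ × (κ → ℝ) =>
    gramRoot (√(x.1 - x.2 ⬝ᵥ x.2)) (√(1 + x.1)) x.2 i k := by
  simp only [gramRoot, dotProduct]
  rcases i with i | i <;> rcases k with k | k
  · exact measurable_const
  · simp only [fromBlocks_apply₁₂, of_apply]
    fun_prop
  · fin_cases i <;> simp; fun_prop
  · fin_cases i <;> fin_cases k <;> simp <;> fun_prop

theorem measurable_tubeDensitySplit {p : ℕ} (E : Fin (p + 1) → ℂ) (α : ℝ) :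
    Measurable (tubeDensitySplit (κ := κ) E α) := by
  have hy : Measurable fun x : (ℝ × (κ → ℝ)) × ((Fin p → κ ⊕ Fin 2 → ℝ) × (Fin p → Fin p → ℝ)) =>
      x.1.1 - x.1.2 ⬝ᵥ x.1.2 := by
    simp only [dotProduct]; fun_prop
  refine Measurable.ite (measurableSet_lt measurable_const hy) (Measurable.mul ?_ ?_)
    measurable_const
  · fun_prop
  · refine (measurable_tubeDensity _ _).comp (Measurable.prodMk ?_ (by fun_prop))
    refine measurable_pi_lambda _ fun i => measurable_pi_lambda _ fun k => ?_
    simp only [mulVec, dotProduct]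
    refine Finset.measurable_sum _ fun k' _ => Measurable.mul ?_ (by fun_prop)
    exact (measurable_gramRoot_apply k k').comp measurable_fst

/-- The change of variables, for fixed first row of `L` and first diagonal entry of `X`, that
turns the remaining integrand into `tubeDensity` of size one less. -/
theorem transfers_tubeDensitySplit {p : ℕ} (E : Fin (p + 1) → ℂ) (α : ℝ) :
    Transfers volume volume (tubeDensitySplit (κ := κ) E α)
      (fun x : (ℝ × (κ → ℝ)) × ((Fin p → κ ⊕ Fin 2 → ℝ) × (Fin p → Fin p → ℝ)) =>
        ((2 : ℂ) ^ p * radialDensity (E 0 + p / 2 + 1) (α - p)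
        (x.1.1 - x.1.2 ⬝ᵥ x.1.2, x.1.2)) * tubeDensity (fun j => E j.succ) α x.2) := by
  refine Transfers.prod (measurable_tubeDensitySplit E α).aestronglyMeasurable ?_
  rintro ⟨x, l⟩
  by_cases hy : 0 < x - l ⬝ᵥ l
  swap
  · simp only [tubeDensitySplit, radialDensity, if_neg hy, mul_zero, zero_mul]
    exact Transfers.of_zero
  have hl : 0 ≤ l ⬝ᵥ l := Finset.sum_nonneg fun i _ => mul_self_nonneg _
  have hx : 0 < 1 + x := by linarith
  set B := gramRoot (√(x - l ⬝ᵥ l)) (√(1 + x)) l with hB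
  have hdetB : |B.det| = 1 / (2 * √(x - l ⬝ᵥ l) * (1 + x)) := by
    rw [hB, abs_det_gramRoot (Real.sqrt_pos.2 hy) (Real.sqrt_pos.2 hx)
      (by rw [Real.sq_sqrt hx.le, Real.sq_sqrt hy.le]; ring), Real.sq_sqrt hx.le]
  let f : ((Fin p → κ ⊕ Fin 2 → ℝ) × (Fin p → Fin p → ℝ)) →ₗ[ℝ]
      ((Fin p → κ ⊕ Fin 2 → ℝ) × (Fin p → Fin p → ℝ)) :=
    (LinearMap.pi fun i => toLin' B ∘ₗ LinearMap.proj i).prodMap LinearMap.id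
  have hf : LinearMap.det f = B.det ^ p := by
    simp [f, LinearMap.det_prodMap, LinearMap.det_pi (fun _ : Fin p => toLin' B)]
  have hBne : B.det ≠ 0 := by
    rw [← abs_pos, hdetB]; positivity
  let c : ℂ := (2 : ℂ) ^ p * radialDensity (E 0 + p / 2 + 1) (α - p) (x - l ⬝ᵥ l, l)
  let g : (Fin p → κ ⊕ Fin 2 → ℝ) × (Fin p → Fin p → ℝ) → ℂ :=
    fun z => c * tubeDensity (fun j => E j.succ) α z
  have : ((volume : Measure (Fin p → κ ⊕ Fin 2 → ℝ)).prod
      (volume : Measure (Fin p → Fin p → ℝ))).IsAddHaarMeasure :=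
    Measure.prod.instIsAddHaarMeasure _ _
  have t2 := Transfers.of_linearMap
    ((volume : Measure (Fin p → κ ⊕ Fin 2 → ℝ)).prod (volume : Measure (Fin p → Fin p → ℝ)))
    (f := f) (by rw [hf]; exact pow_ne_zero _ hBne) g
  have hshear : MeasurePreserving
      (fun z : (Fin p → κ ⊕ Fin 2 → ℝ) × (Fin p → Fin p → ℝ) => (z.1,
        z.2 - fun i j => z.1 i (Sum.inr 1) * z.1 j (Sum.inr 0) / (1 + x)))
      (volume.prod volume) (volume.prod volume) := by
    refine (MeasurePreserving.id volume).skew_product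
      (g := fun (P : Fin p → κ ⊕ Fin 2 → ℝ) (X : Fin p → Fin p → ℝ) =>
        X - fun i j => P i (Sum.inr 1) * P j (Sum.inr 0) / (1 + x)) ?_
      (Filter.Eventually.of_forall fun P => (measurePreserving_sub_right volume _).map_eq)
    refine measurable_snd.sub ?_
    fun_prop
  have t1 := Transfers.of_measurePreserving hshear
    (fun z => ((|LinearMap.det f| : ℝ) : ℂ) * g (f z))
  refine Eq.mp ?_ (t1.trans t2)
  congr 1
  funext z
  -- The Jacobian `(2 √y (1 + x))⁻ᵖ` accounts for the factor `2 ^ p` and for the shifts of both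
  -- exponents of `radialDensity`.
  have hc : ((|LinearMap.det f| : ℝ) : ℂ) * c =
      ((x - l ⬝ᵥ l : ℝ) : ℂ) ^ E 0 * (((1 + x) ^ (-α) : ℝ) : ℂ) := by
    have hsum : 1 + (x - l ⬝ᵥ l) + ∑ i, l i ^ 2 = 1 + x := by
      simp only [dotProduct, ← pow_two]; ring
    have hyc : ((x - l ⬝ᵥ l : ℝ) : ℂ) ≠ 0 := by exact_mod_cast hy.ne'
    have e1 : (1 + x) ^ (-(α - p)) = (1 + x) ^ (-α) * (1 + x) ^ p := by
      rw [← Real.rpow_natCast, ← Real.rpow_add hx]; congr 1; ring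
    have e2 : ((x - l ⬝ᵥ l : ℝ) : ℂ) ^ (E 0 + (p : ℂ) / 2 + 1 - 1) =
        ((x - l ⬝ᵥ l : ℝ) : ℂ) ^ E 0 * ((√(x - l ⬝ᵥ l) ^ p : ℝ) : ℂ) := by
      rw [add_sub_cancel_right, Complex.cpow_add _ _ hyc, Real.sqrt_eq_rpow, ← Real.rpow_natCast,
        ← Real.rpow_mul hy.le, Complex.ofReal_cpow hy.le]
      congr 2
      push_cast
      ring
    simp only [c, radialDensity, if_pos hy, hsum]
    rw [e1, e2, hf, abs_pow, hdetB]
    have h1 : (√(x - l ⬝ᵥ l) : ℂ) ≠ 0 := by exact_mod_cast (Real.sqrt_pos.2 hy).ne'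
    have h2 : (1 + x : ℂ) ≠ 0 := by exact_mod_cast hx.ne'
    push_cast
    rw [div_pow, mul_pow, mul_pow, one_pow]
    field_simp
  simp only [tubeDensitySplit, if_pos hy]
  rw [← hc, mul_assoc]
  rfl

/-- The `k`-th factor of the integral of `tubeDensity`, where `m` is the number of columns
of `L`. -/
noncomputable def tubeFactor (p : ℕ) (m : ℕ) (E : Fin p → ℂ) (α : ℝ) (k : Fin p) : ℂ :=
  2 ^ (p - 1 - (k : ℕ)) * ((Real.pi ^ (((m + 2 * k : ℕ) : ℝ) / 2) : ℝ) : ℂ) *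
    Complex.Gamma (E k + (p - 1 - k : ℕ) / 2 + 1) *
    Complex.Gamma (α - (p - 1 - k : ℕ) - (E k + (p - 1 - k : ℕ) / 2 + 1) - (m + 2 * k : ℕ) / 2) /
    Complex.Gamma (α - (p - 1 - k : ℕ))

end Tube

/-- The integral over all `(L, X)`, by induction on the size of the matrices: each step splits off
one `radialDensity` and adds two columns to `L`. -/
theorem integrable_tubeDensity_and_integral (α : ℝ) : ∀ (p : ℕ) (κ : Type) [Fintype κ]
    (E : Fin p → ℂ), (∀ k : Fin p, 0 < (E k + (p - 1 - k : ℕ) / 2 + 1).re) →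
    (∀ k : Fin p, 0 < ((α : ℂ) - (p - 1 - k : ℕ) - (E k + (p - 1 - k : ℕ) / 2 + 1) -
      (Fintype.card κ + 2 * k : ℕ) / 2).re) →
    Integrable (tubeDensity (κ := κ) E α) ∧
    ∫ x, tubeDensity (κ := κ) E α x = ∏ k, tubeFactor p (Fintype.card κ) E α k
  | 0, κ, _, E, _, _ => by
    have h1 : tubeDensity (κ := κ) E α = fun _ => 1 := by
      funext x
      simp [tubeDensity, pivotPower]
    have h2 : volume (Set.univ : Set ((Fin 0 → κ → ℝ) × (Fin 0 → Fin 0 → ℝ))) = 1 := by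
      rw [Measure.volume_eq_prod, ← Set.univ_prod_univ, Measure.prod_prod]
      simp [volume_pi]
    have : IsFiniteMeasure (volume : Measure ((Fin 0 → κ → ℝ) × (Fin 0 → Fin 0 → ℝ))) :=
      ⟨by rw [h2]; exact ENNReal.one_lt_top⟩
    rw [h1]
    exact ⟨integrable_const _, by simp [Measure.real, h2]⟩
  | p + 1, κ, _, E, hE, hE' => by
    classical
    have e0 : ∀ k : Fin p, p + 1 - 1 - (k.succ : ℕ) = p - 1 - k := fun k => by
      simp; omega
    have e1 : ∀ k : Fin p, Fintype.card κ + 2 * (k.succ : ℕ) =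
        Fintype.card (κ ⊕ Fin 2) + 2 * k := fun k => by
      simp; ring
    obtain ⟨hI, hv⟩ := integrable_tubeDensity_and_integral α p (κ ⊕ Fin 2) (fun j => E j.succ)
      (fun k => by have := hE k.succ; rwa [e0] at this)
      (fun k => by have := hE' k.succ; rwa [e0, e1] at this)
    have ha : 0 < (E 0 + p / 2 + 1).re := by simpa using hE 0
    have hb : 0 < (((α - p : ℝ) : ℂ) - (E 0 + p / 2 + 1) - (Fintype.card κ : ℂ) / 2).re := by
      simpa using hE' 0
    obtain ⟨hR, hRv⟩ := integrable_radialDensity_and_integral (κ := κ) ha hb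
    have hshear : MeasurePreserving (fun x : ℝ × (κ → ℝ) => (x.1 - x.2 ⬝ᵥ x.2, x.2)) := by
      refine (Measure.measurePreserving_swap (μ := (volume : Measure (κ → ℝ)))
        (ν := (volume : Measure ℝ))).comp
        (MeasurePreserving.comp ((MeasurePreserving.id volume).skew_product
          (g := fun (l : κ → ℝ) (x : ℝ) => x - l ⬝ᵥ l) ?_
          (Filter.Eventually.of_forall fun l => (measurePreserving_sub_right volume _).map_eq))
          Measure.measurePreserving_swap)
      refine measurable_snd.sub ?_
      simp only [dotProduct]
      fun_prop
    have t1 := Transfers.of_measurePreserving (measurePreserving_splitFirst p κ)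
      (tubeDensitySplit E α)
    rw [← funext (tubeDensity_eq_split E α)] at t1
    have t2 := transfers_tubeDensitySplit (κ := κ) E α
    have t3 := Transfers.of_measurePreserving
      (hshear.prod (MeasurePreserving.id
        (volume : Measure ((Fin p → κ ⊕ Fin 2 → ℝ) × (Fin p → Fin p → ℝ)))))
      (fun x => ((2 : ℂ) ^ p * radialDensity (E 0 + p / 2 + 1) (α - p) x.1) *
        tubeDensity (fun j => E j.succ) α x.2)
    obtain ⟨h1, -, h2⟩ := (t1.trans (t2.trans t3)) ((hR.const_mul _).mul_prod hI)
    refine ⟨h1, h2.trans ?_⟩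
    rw [integral_prod_mul (fun x : ℝ × (κ → ℝ) =>
      (2 : ℂ) ^ p * radialDensity (E 0 + p / 2 + 1) (α - p) x)
      (tubeDensity (κ := κ ⊕ Fin 2) (fun j => E j.succ) α), integral_const_mul, hv, hRv,
      Fin.prod_univ_succ]
    congr 1
    · simp [tubeFactor]
      ring
    · refine Finset.prod_congr rfl fun k _ => ?_
      simp only [tubeFactor, e0, e1]

/-! ### The Cayley transform -/

section LinearMaps

variable {p : ℕ} {κ : Type*} [Fintype κ]

/-- Left multiplication by a square matrix, on rectangular arrays. -/
def leftMul (κ : Type*) (A : Matrix (Fin p) (Fin p) ℝ) : (Fin p → κ → ℝ) →ₗ[ℝ] (Fin p → κ → ℝ) :=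
  mulLeftLinearMap κ ℝ A

theorem det_leftMul (A : Matrix (Fin p) (Fin p) ℝ) :
    LinearMap.det (leftMul κ A) = A.det ^ Fintype.card κ := by
  let e : (κ → Fin p → ℝ) ≃ₗ[ℝ] (Fin p → κ → ℝ) := transposeLinearEquiv κ (Fin p) ℝ ℝ
  have h : leftMul κ A = e.toLinearMap ∘ₗ
      (LinearMap.pi fun i => toLin' A ∘ₗ LinearMap.proj i) ∘ₗ e.symm.toLinearMap := by
    refine LinearMap.ext fun L => ?_
    funext i k
    rfl
  rw [h, LinearMap.det_conj, LinearMap.det_pi (fun _ : κ => toLin' A)]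
  simp

variable [DecidableEq κ]

/-- Right multiplication by a square matrix, on rectangular arrays. -/
def rightMul (p : ℕ) (B : Matrix κ κ ℝ) : (Fin p → κ → ℝ) →ₗ[ℝ] (Fin p → κ → ℝ) :=
  mulRightLinearMap (Fin p) ℝ B

theorem det_rightMul (B : Matrix κ κ ℝ) : LinearMap.det (rightMul p B) = B.det ^ p := by
  have h : rightMul p B = LinearMap.pi fun i => toLin' Bᵀ ∘ₗ LinearMap.proj i := by
    ext P i k
    simp [rightMul, mulVec_transpose, vecMul_eq_sum]
    rfl
  rw [h, LinearMap.det_pi (fun _ : Fin p => toLin' Bᵀ)]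
  simp

end LinearMaps

/-- Change of variables for an injective map and a function supported in its image. -/
theorem Transfers.of_injOn {E : Type*} [NormedAddCommGroup E] [NormedSpace ℝ E]
    [FiniteDimensional ℝ E] [MeasurableSpace E] [BorelSpace E] (μ : Measure E)
    [μ.IsAddHaarMeasure] {s : Set E} (hs : MeasurableSet s) {f : E → E} {f' : E → E →L[ℝ] E}
    (hf' : ∀ x ∈ s, HasFDerivWithinAt f (f' x) s x) (hf : Set.InjOn f s) {F : E → ℂ}
    (hF0 : ∀ x ∉ f '' s, F x = 0) :
    Transfers μ μ (s.indicator fun x => ((|(f' x).det| : ℝ) : ℂ) * F (f x)) F := fun hF => by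
  have h1 := (integrableOn_image_iff_integrableOn_abs_det_fderiv_smul μ hs hf' hf F).1
    hF.integrableOn
  have h2 := integral_image_eq_integral_abs_det_fderiv_smul μ hs hf' hf F
  have h3 := integral_image_eq_integral_abs_det_fderiv_smul μ hs hf' hf fun x => ‖F x‖
  rw [setIntegral_eq_integral_of_forall_compl_eq_zero hF0] at h2
  rw [setIntegral_eq_integral_of_forall_compl_eq_zero fun x hx => by rw [hF0 x hx, norm_zero]] at h3
  refine ⟨(integrable_indicator_iff hs).2 h1, ?_, ?_⟩
  · rw [h3]
    simp only [norm_indicator_eq_indicator_norm]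
    rw [integral_indicator hs]
    simp
  · rw [h2, integral_indicator hs]
    rfl

section Cayley

variable {p : ℕ}

/-- The Cayley transform in the form `2 (1 + z)⁻¹ - 1`, on square arrays; meaningful only if
`1 + z` is invertible. -/
noncomputable def cayleyMap (z : Fin p → Fin p → ℝ) : Fin p → Fin p → ℝ :=
  fun i j => ((2 : ℝ) • (1 + of z)⁻¹ - 1 : Matrix (Fin p) (Fin p) ℝ) i j

theorem of_cayleyMap (z : Fin p → Fin p → ℝ) :
    of (cayleyMap z) = (2 : ℝ) • (1 + of z)⁻¹ - 1 := rfl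

theorem one_add_cayleyMap (z : Fin p → Fin p → ℝ) :
    1 + of (cayleyMap z) = (2 : ℝ) • (1 + of z)⁻¹ := by
  rw [of_cayleyMap]
  abel

theorem det_one_add_cayleyMap (z : Fin p → Fin p → ℝ) :
    (1 + of (cayleyMap z)).det = 2 ^ p * (1 + of z).det⁻¹ := by
  rw [one_add_cayleyMap, det_smul, det_nonsing_inv, Ring.inverse_eq_inv', Fintype.card_fin]

theorem cayleyMap_cayleyMap {z : Fin p → Fin p → ℝ} (hz : (1 + of z).det ≠ 0) :
    cayleyMap (cayleyMap z) = z := by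
  have h : (1 + of (cayleyMap z))⁻¹ = (1 / 2 : ℝ) • (1 + of z) := by
    refine inv_eq_right_inv ?_
    rw [one_add_cayleyMap, smul_mul_smul_comm, nonsing_inv_mul _ (Ne.isUnit hz)]
    norm_num
  refine of.injective ?_
  rw [of_cayleyMap, h, smul_smul]
  norm_num

theorem measurable_det_one_add : Measurable fun z : Fin p → Fin p → ℝ => (1 + of z).det :=
  measurable_det fun i j => by simp only [Matrix.add_apply, of_apply]; fun_prop

/-- The derivative `H ↦ -2 (1 + z)⁻¹ H (1 + z)⁻¹` of the Cayley transform. -/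
noncomputable def cayleyDeriv (z : Fin p → Fin p → ℝ) :
    (Fin p → Fin p → ℝ) →L[ℝ] (Fin p → Fin p → ℝ) :=
  LinearMap.toContinuousLinearMap
    ((-2 : ℝ) • (leftMul (Fin p) (1 + of z)⁻¹ ∘ₗ rightMul p (1 + of z)⁻¹))

theorem abs_det_cayleyDeriv (z : Fin p → Fin p → ℝ) :
    |(cayleyDeriv z).det| = 2 ^ (p * p) * (|(1 + of z).det|⁻¹) ^ (2 * p) := by
  rw [cayleyDeriv, LinearMap.det_toContinuousLinearMap, LinearMap.det_smul, LinearMap.det_comp,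
    det_leftMul, det_rightMul, det_nonsing_inv, Ring.inverse_eq_inv']
  simp [abs_mul, abs_pow, abs_inv, Module.finrank_pi_fintype]
  rw [two_mul, pow_add, mul_inv]

section
open scoped Matrix.Norms.Operator

theorem hasFDerivAt_cayleyMap {z : Fin p → Fin p → ℝ} (hz : (1 + of z).det ≠ 0) :
    HasFDerivAt cayleyMap (cayleyDeriv z) z := by
  have hu : IsUnit (1 + of z) := (isUnit_iff_isUnit_det _).2 (Ne.isUnit hz)
  obtain ⟨u, hu⟩ := hu
  have h1 : HasFDerivAt (fun w : Matrix (Fin p) (Fin p) ℝ => 1 + w)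
      (ContinuousLinearMap.id ℝ (Matrix (Fin p) (Fin p) ℝ)) (of z) :=
    (hasFDerivAt_id (𝕜 := ℝ) (of z)).const_add 1
  have h2 := hasFDerivAt_ringInverse (𝕜 := ℝ) u
  rw [hu] at h2
  have h3 := ((h2.comp (of z) h1).const_smul (2 : ℝ)).sub_const (1 : Matrix (Fin p) (Fin p) ℝ)
  have hinv : (↑u⁻¹ : Matrix (Fin p) (Fin p) ℝ) = (1 + of z)⁻¹ := by
    rw [← hu, coe_units_inv]
  have hfun : (fun w : Matrix (Fin p) (Fin p) ℝ => (2 : ℝ) • (Ring.inverse ∘ (1 + ·)) w - 1) =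
      fun w : Matrix (Fin p) (Fin p) ℝ => (2 : ℝ) • (1 + w)⁻¹ - 1 := by
    funext w
    rw [nonsing_inv_eq_ringInverse]
    rfl
  have hderiv : (2 : ℝ) • ((-ContinuousLinearMap.mulLeftRight ℝ (Matrix (Fin p) (Fin p) ℝ)
      ↑u⁻¹ ↑u⁻¹).comp (ContinuousLinearMap.id ℝ (Matrix (Fin p) (Fin p) ℝ))) = cayleyDeriv z := by
    refine ContinuousLinearMap.ext fun H => ?_
    change (2 : ℝ) • -((↑u⁻¹ : Matrix (Fin p) (Fin p) ℝ) * H * (↑u⁻¹ : Matrix (Fin p) (Fin p) ℝ)) =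
      (-2 : ℝ) • ((1 + of z)⁻¹ * (H * (1 + of z)⁻¹))
    rw [hinv, Matrix.mul_assoc]
    module
  refine (h3.congr_fderiv hderiv).congr_of_eventuallyEq (Filter.Eventually.of_forall fun w => ?_)
  exact congrFun hfun.symm w

end

/-- The Cayley transform is an involution of the set where `1 + z` is invertible, with Jacobian
`2^{p²} |det(1 + z)|^{-2p}`. -/
theorem transfers_cayleyMap {F : (Fin p → Fin p → ℝ) → ℂ}
    (hF : ∀ X, (1 + of X).det = 0 → F X = 0) :
    Transfers volume volume (fun z : Fin p → Fin p → ℝ => if (1 + of z).det ≠ 0 then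
      ((2 ^ (p * p) * (|(1 + of z).det|⁻¹) ^ (2 * p) : ℝ) : ℂ) * F (cayleyMap z) else 0) F := by
  classical
  let s : Set (Fin p → Fin p → ℝ) := {z | (1 + of z).det ≠ 0}
  have hs : MeasurableSet s := (measurableSet_singleton 0).compl.preimage measurable_det_one_add
  have hmaps : ∀ z ∈ s, cayleyMap z ∈ s := fun z hz => by
    have hz' : (1 + of z).det ≠ 0 := hz
    change (1 + of (cayleyMap z)).det ≠ 0
    rw [det_one_add_cayleyMap]
    positivity
  have hinj : Set.InjOn cayleyMap s := fun z hz w hw h => by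
    rw [← cayleyMap_cayleyMap hz, ← cayleyMap_cayleyMap hw, h]
  have key := Transfers.of_injOn volume hs
    (fun z hz => (hasFDerivAt_cayleyMap hz).hasFDerivWithinAt) hinj (F := F) fun X hX => by
      refine hF X (by_contra fun h => hX ?_)
      exact ⟨cayleyMap X, hmaps X h, cayleyMap_cayleyMap h⟩
  convert key using 1
  funext z
  rw [Set.indicator_apply, abs_det_cayleyDeriv]
  rfl

variable {κ : Type*} [Fintype κ]

/-- The integrand in the ball corresponding to the function `F` of `(L, X)`, where
`X = (1 - z₂)(1 + z₂)⁻¹` and `L = -(1 + z₂)⁻¹ z₁`, with the Jacobian of `z ↦ (L, X)`; it vanishes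
where `1 + z₂` is singular. -/
noncomputable def cayleyPullback (F : (Fin p → κ → ℝ) × (Fin p → Fin p → ℝ) → ℂ)
    (z : (Fin p → κ → ℝ) × (Fin p → Fin p → ℝ)) : ℂ :=
  if (1 + of z.2).det ≠ 0 then
    ((2 ^ (p * p) * (|(1 + of z.2).det|⁻¹) ^ (2 * p + Fintype.card κ) : ℝ) : ℂ) *
      F (-((1 + of z.2)⁻¹ * of z.1), cayleyMap z.2)
  else 0

theorem measurable_inv_one_add_apply (i j : Fin p) :
    Measurable fun z : Fin p → Fin p → ℝ => (1 + of z)⁻¹ i j :=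
  measurable_inv_apply (fun i j => by simp only [Matrix.add_apply, of_apply]; fun_prop) i j

theorem measurable_cayleyMap : Measurable (cayleyMap (p := p)) := by
  refine measurable_pi_lambda _ fun i => measurable_pi_lambda _ fun j => ?_
  exact ((measurable_inv_one_add_apply i j).const_mul 2).sub_const
    ((1 : Matrix (Fin p) (Fin p) ℝ) i j)

/-- The Cayley transform in `z₂`, for fixed `L`, composed with the linear substitution
`L = -(1 + z₂)⁻¹ z₁`, for fixed `z₂`. -/
theorem transfers_cayleyPullback {F : (Fin p → κ → ℝ) × (Fin p → Fin p → ℝ) → ℂ}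
    (hFm : Measurable F) (hF : ∀ x, (1 + of x.2).det = 0 → F x = 0) :
    Transfers volume volume (cayleyPullback F) F := by
  let G : (Fin p → κ → ℝ) × (Fin p → Fin p → ℝ) → ℂ := fun x => if (1 + of x.2).det ≠ 0 then
      ((2 ^ (p * p) * (|(1 + of x.2).det|⁻¹) ^ (2 * p) : ℝ) : ℂ) * F (x.1, cayleyMap x.2) else 0
  have hdet : Measurable fun x : (Fin p → κ → ℝ) × (Fin p → Fin p → ℝ) => (1 + of x.2).det :=
    measurable_det_one_add.comp measurable_snd
  have hset : MeasurableSet {x : (Fin p → κ → ℝ) × (Fin p → Fin p → ℝ) | (1 + of x.2).det ≠ 0} :=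
    (measurableSet_singleton 0).compl.preimage hdet
  have hdetn : Measurable fun x : (Fin p → κ → ℝ) × (Fin p → Fin p → ℝ) =>
      |(1 + of x.2).det|⁻¹ := (measurable_norm.comp hdet).inv
  have hG : Measurable G := by
    refine Measurable.ite hset (Measurable.mul ?_ (hFm.comp ?_)) measurable_const
    · exact Complex.measurable_ofReal.comp ((hdetn.pow_const _).const_mul _)
    · exact measurable_fst.prodMk (measurable_cayleyMap.comp measurable_snd)
  have hP : Measurable (cayleyPullback F) := by
    refine Measurable.ite hset (Measurable.mul ?_ (hFm.comp ?_)) measurable_const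
    · exact Complex.measurable_ofReal.comp ((hdetn.pow_const _).const_mul _)
    · refine Measurable.prodMk ?_ (measurable_cayleyMap.comp measurable_snd)
      refine measurable_pi_lambda _ fun i => measurable_pi_lambda _ fun k => ?_
      refine Measurable.neg ?_
      simp only [mul_apply, of_apply]
      refine Finset.measurable_sum _ fun j _ => Measurable.mul ?_ (by fun_prop)
      exact (measurable_inv_one_add_apply i j).comp measurable_snd
  have t1 : Transfers volume volume G F := Transfers.prod hG.aestronglyMeasurable fun L =>
    transfers_cayleyMap fun X hX => hF (L, X) hX
  have t2 : Transfers ((volume : Measure (Fin p → Fin p → ℝ)).prod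
      (volume : Measure (Fin p → κ → ℝ))) (volume.prod volume)
      (fun x => cayleyPullback F x.swap) (fun x => G x.swap) := by
    refine Transfers.prod (hP.comp measurable_swap).aestronglyMeasurable fun z => ?_
    by_cases hz : (1 + of z).det = 0
    · simp only [cayleyPullback, G, Prod.swap_prod_mk, hz, ne_eq, not_true_eq_false, if_false]
      exact Transfers.of_zero
    have hd : LinearMap.det (leftMul κ (-(1 + of z)⁻¹)) =
        (-(1 + of z)⁻¹).det ^ Fintype.card κ := det_leftMul _
    have hd' : |LinearMap.det (leftMul κ (-(1 + of z)⁻¹))| =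
        (|(1 + of z).det|⁻¹) ^ Fintype.card κ := by
      rw [hd, det_neg, det_nonsing_inv, Ring.inverse_eq_inv']
      simp [abs_mul, abs_pow, abs_inv]
    have key := Transfers.of_linearMap (volume : Measure (Fin p → κ → ℝ))
      (f := leftMul κ (-(1 + of z)⁻¹)) (by
        rw [← abs_pos, hd']; positivity) (fun L => G (L, z))
    convert key using 1
    swap
    · rfl
    funext y
    have hy : leftMul κ (-(1 + of z)⁻¹) y = -((1 + of z)⁻¹ * of y) :=
      Matrix.neg_mul (1 + of z)⁻¹ (of y)
    simp only [cayleyPullback, G, Prod.swap_prod_mk, ne_eq, hz, not_false_eq_true, if_true]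
    rw [hd', hy, pow_add]
    push_cast
    ring
  have t3 := Transfers.swap (μ := (volume : Measure (Fin p → Fin p → ℝ)))
    (ν := (volume : Measure (Fin p → κ → ℝ))) (fun x => cayleyPullback F x.swap)
  have t4 := Transfers.swap (μ := (volume : Measure (Fin p → κ → ℝ)))
    (ν := (volume : Measure (Fin p → Fin p → ℝ))) G
  exact t3.trans (t2.trans (t4.trans t1))

end Cayley

/-! ### The matrix ball and averaging over the compact group -/

instance sigmaFinite_volume_matrix (p q : ℕ) :
    SigmaFinite (volume : Measure (Matrix (Fin p) (Fin q) ℝ)) :=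
  inferInstanceAs (SigmaFinite (volume : Measure (Fin p → Fin q → ℝ)))

section Ball

variable {p q : ℕ}

theorem isHermitian_one_sub_mul_transpose (z : Matrix (Fin p) (Fin q) ℝ) :
    (1 - z * zᵀ).IsHermitian := by
  simp [Matrix.IsHermitian]

theorem dotProduct_mul_transpose_mulVec {m n : Type*} [Fintype m] [Fintype n] (B : Matrix m n ℝ)
    (v : m → ℝ) : v ⬝ᵥ ((B * Bᵀ) *ᵥ v) = (Bᵀ *ᵥ v) ⬝ᵥ (Bᵀ *ᵥ v) := by
  rw [← mulVec_mulVec, dotProduct_mulVec, mulVec_transpose]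

theorem dotProduct_one_sub_mul_transpose (z : Matrix (Fin p) (Fin q) ℝ) (v : Fin p → ℝ) :
    star v ⬝ᵥ ((1 - z * zᵀ) *ᵥ v) = v ⬝ᵥ v - (zᵀ *ᵥ v) ⬝ᵥ (zᵀ *ᵥ v) := by
  rw [star_trivial, sub_mulVec, one_mulVec, dotProduct_sub, dotProduct_mul_transpose_mulVec]

/-- The operator norm is attained on the compact unit sphere, so `‖z‖ < 1` means `|vz| < |v|`
for every `v ≠ 0`. -/
theorem mem_matrixBall_iff (z : Matrix (Fin p) (Fin q) ℝ) :
    z ∈ matrixBall p q ↔ (1 - z * zᵀ).PosDef := by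
  set T := LinearMap.toContinuousLinearMap (toEuclideanLin zᵀ) with hT
  have hTv : ∀ v : EuclideanSpace ℝ (Fin p), ‖T v‖ ^ 2 = (zᵀ *ᵥ v.ofLp) ⬝ᵥ (zᵀ *ᵥ v.ofLp) := by
    intro v
    rw [EuclideanSpace.real_norm_sq_eq]
    simp only [dotProduct, pow_two]
    rfl
  have hv : ∀ v : EuclideanSpace ℝ (Fin p), ‖v‖ ^ 2 = v.ofLp ⬝ᵥ v.ofLp := fun v => by
    rw [EuclideanSpace.real_norm_sq_eq]
    simp only [dotProduct, pow_two]
  constructor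
  · intro h
    have h' : ‖T‖ < 1 := h
    refine .of_dotProduct_mulVec_pos (isHermitian_one_sub_mul_transpose z) fun {v} hne => ?_
    rw [dotProduct_one_sub_mul_transpose]
    have h1 := hTv (WithLp.toLp 2 v)
    have h2 := hv (WithLp.toLp 2 v)
    have h3 : 0 < ‖WithLp.toLp 2 v‖ := norm_pos_iff.2 (by simpa using hne)
    have h4 : ‖T (WithLp.toLp 2 v)‖ < ‖WithLp.toLp 2 v‖ :=
      (T.le_opNorm _).trans_lt (by nlinarith)
    have h5 := pow_lt_pow_left₀ h4 (norm_nonneg _) two_ne_zero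
    rw [h1, h2] at h5
    exact sub_pos.2 h5
  · intro h
    change ‖T‖ < 1
    have hlt : ∀ v : EuclideanSpace ℝ (Fin p), ‖v‖ = 1 → ‖T v‖ < 1 := by
      intro v hv1
      have hne : v.ofLp ≠ 0 := by
        intro h0
        have : v = 0 := by ext i; exact congrFun h0 i
        simp [this] at hv1
      have h1 := h.dotProduct_mulVec_pos hne
      rw [dotProduct_one_sub_mul_transpose, ← hTv, ← hv, hv1] at h1
      nlinarith [norm_nonneg (T v)]
    rcases (Metric.sphere (0 : EuclideanSpace ℝ (Fin p)) 1).eq_empty_or_nonempty with he | hne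
    · refine (ContinuousLinearMap.opNorm_le_of_unit_norm le_rfl fun v hv1 => ?_).trans_lt one_pos
      have : v ∈ Metric.sphere (0 : EuclideanSpace ℝ (Fin p)) 1 := by simpa using hv1
      simp [he] at this
    · obtain ⟨v₀, hv₀, hmax⟩ := (isCompact_sphere (0 : EuclideanSpace ℝ (Fin p)) 1).exists_isMaxOn
        hne (T.continuous.norm.continuousOn)
      refine (ContinuousLinearMap.opNorm_le_of_unit_norm (norm_nonneg (T v₀)) fun v hv1 =>
        hmax (by simpa using hv1)).trans_lt (hlt v₀ (by simpa using hv₀))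

theorem det_one_sub_transpose_mul (z : Matrix (Fin p) (Fin q) ℝ) :
    (1 - zᵀ * z).det = (1 - z * zᵀ).det := by
  rw [det_one_sub_mul_comm]

theorem measurableSet_matrixBall : MeasurableSet (matrixBall p q) := by
  have h : IsOpen (matrixBall p q) := by
    refine isOpen_lt (continuous_norm.comp ?_) continuous_const
    let Λ : Matrix (Fin p) (Fin q) ℝ →ₗ[ℝ]
        (EuclideanSpace ℝ (Fin p) →L[ℝ] EuclideanSpace ℝ (Fin q)) :=
      LinearMap.toContinuousLinearMap.toLinearMap ∘ₗ toEuclideanLin.toLinearMap ∘ₗ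
        (transposeLinearEquiv (Fin p) (Fin q) ℝ ℝ).toLinearMap
    exact Λ.continuous_of_finiteDimensional
  exact h.measurableSet

theorem measurable_det_one_sub_transpose_mul :
    Measurable fun z : Matrix (Fin p) (Fin q) ℝ => (1 - zᵀ * z).det := by
  refine measurable_det fun i j => ?_
  simp only [Matrix.sub_apply, mul_apply, transpose_apply]
  exact measurable_const.sub (Finset.measurable_sum _ fun k _ =>
    (measurable_matrix_apply k i).mul (measurable_matrix_apply k j))

theorem measurable_berezin (α : ℝ) : Measurable (berezin (p := p) (q := q) α) := by
  unfold berezin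
  simp only [← det_one_sub_transpose_mul]
  exact measurable_det_one_sub_transpose_mul.pow_const _

theorem measurable_psi (h : p ≤ q) (s : Fin p → ℂ) : Measurable (psi h s) := by
  have h1 : ∀ i j, Measurable fun z : Matrix (Fin p) (Fin q) ℝ => squareBlock h z i j := by
    rintro (i | i) (j | j)
    · exact measurable_const
    · exact measurable_const
    · exact measurable_matrix_apply _ _
    · exact measurable_matrix_apply _ _
  have h2 : ∀ i j, Measurable fun z : Matrix (Fin p) (Fin q) ℝ => cayley (squareBlock h z) i j := by
    intro i j
    simp only [cayley, mul_apply]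
    refine Finset.measurable_sum _ fun k _ => Measurable.mul ?_ ?_
    · exact measurable_const.sub (h1 i k)
    · exact measurable_inv_apply (fun i j => measurable_const.add (h1 i j)) k j
  have h3 : ∀ i j, Measurable fun z : Matrix (Fin p) (Fin q) ℝ =>
      wedgeSchur (cayley (squareBlock h z)) i j := by
    intro i j
    simp only [wedgeSchur, Matrix.sub_apply, mul_apply, transpose_apply, Matrix.smul_apply,
      Matrix.add_apply, toBlocks₂₁, toBlocks₂₂, of_apply, smul_eq_mul]
    exact (((h2 _ _).add (h2 _ _)).const_mul _).sub (Finset.measurable_sum _ fun k _ =>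
      ((h2 _ _).const_mul _).mul ((h2 _ _).const_mul _))
  unfold psi
  refine Finset.measurable_prod _ fun j _ => Measurable.pow_const ?_ _
  exact Complex.measurable_ofReal.comp (measurable_det fun i k => h3 _ _)

end Ball

section Invariance

variable {p q : ℕ}

/-- The density of the invariant measure. -/
noncomputable def invariantDensity (p q : ℕ) (z : Matrix (Fin p) (Fin q) ℝ) : ENNReal :=
  ENNReal.ofReal ((1 - zᵀ * z).det ^ (-((p : ℝ) + q) / 2))

theorem measurable_invariantDensity : Measurable (invariantDensity p q) :=
  ENNReal.measurable_ofReal.comp (measurable_det_one_sub_transpose_mul.pow_const _)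

instance sFinite_invariantMeasure (p q : ℕ) : SFinite (invariantMeasure p q) := by
  unfold invariantMeasure
  infer_instance

/-- The action of `(a, d) ∈ O(p) × O(q)` on the matrix ball. -/
def rotate (k : orthogonalGroup (Fin p) ℝ × orthogonalGroup (Fin q) ℝ)
    (z : Matrix (Fin p) (Fin q) ℝ) : Matrix (Fin p) (Fin q) ℝ :=
  (k.1⁻¹).val * z * k.2.val

theorem abs_det_orthogonal {n : ℕ} (a : orthogonalGroup (Fin n) ℝ) : |a.val.det| = 1 := by
  have h := (mem_orthogonalGroup_iff (Fin n) ℝ).1 a.2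
  have h2 := congrArg det h
  rw [det_mul, det_transpose, det_one] at h2
  rcases mul_self_eq_one_iff.1 h2 with h3 | h3 <;> simp [h3]

theorem measurePreserving_rotate_volume
    (k : orthogonalGroup (Fin p) ℝ × orthogonalGroup (Fin q) ℝ) :
    MeasurePreserving (rotate k) := by
  let f := leftMul (Fin q) (k.1⁻¹).val ∘ₗ rightMul p k.2.val
  have hf : |LinearMap.det f| = 1 := by
    rw [LinearMap.det_comp, det_leftMul, det_rightMul, abs_mul, abs_pow, abs_pow,
      abs_det_orthogonal, abs_det_orthogonal]
    simp
  have hf0 : LinearMap.det f ≠ 0 := by rw [← abs_pos, hf]; exact one_pos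
  have hrot : (rotate k : (Fin p → Fin q → ℝ) → (Fin p → Fin q → ℝ)) = f := by
    funext z
    exact Matrix.mul_assoc (k.1⁻¹).val (of z) k.2.val
  have h1 : MeasurePreserving f (volume : Measure (Fin p → Fin q → ℝ)) volume :=
    ⟨f.continuous_of_finiteDimensional.measurable, by
      rw [Measure.map_linearMap_addHaar_eq_smul_addHaar _ hf0, abs_inv, hf]
      simp⟩
  rw [← hrot] at h1
  exact h1

theorem one_sub_rotate_mul_transpose
    (k : orthogonalGroup (Fin p) ℝ × orthogonalGroup (Fin q) ℝ) (z : Matrix (Fin p) (Fin q) ℝ) :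
    1 - rotate k z * (rotate k z)ᵀ = star k.1.val * (1 - z * zᵀ) * k.1.val := by
  have hd : k.2.val * k.2.valᵀ = 1 := (mem_orthogonalGroup_iff (Fin q) ℝ).1 k.2.2
  have ha : star k.1.val * k.1.val = 1 := (mem_orthogonalGroup_iff' (Fin p) ℝ).1 k.1.2
  have hinv : (k.1⁻¹).val = star k.1.val := rfl
  have hst : (star k.1.val)ᵀ = k.1.val := by
    rw [star_eq_conjTranspose, conjTranspose_eq_transpose_of_trivial, transpose_transpose]
  rw [rotate, hinv, transpose_mul, transpose_mul, hst, Matrix.mul_sub, Matrix.sub_mul,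
    Matrix.mul_one, ha]
  congr 1
  calc star k.1.val * z * k.2.val * (k.2.valᵀ * (zᵀ * k.1.val))
      = star k.1.val * z * (k.2.val * k.2.valᵀ) * (zᵀ * k.1.val) := by
        simp only [Matrix.mul_assoc]
    _ = _ := by rw [hd]; simp only [Matrix.mul_one, Matrix.mul_assoc]

theorem det_one_sub_rotate
    (k : orthogonalGroup (Fin p) ℝ × orthogonalGroup (Fin q) ℝ) (z : Matrix (Fin p) (Fin q) ℝ) :
    (1 - rotate k z * (rotate k z)ᵀ).det = (1 - z * zᵀ).det := by
  have ha : star k.1.val * k.1.val = 1 := (mem_orthogonalGroup_iff' (Fin p) ℝ).1 k.1.2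
  rw [one_sub_rotate_mul_transpose, det_mul, det_mul, mul_right_comm, ← det_mul, ha, det_one,
    one_mul]

theorem berezin_rotate (α : ℝ) (k : orthogonalGroup (Fin p) ℝ × orthogonalGroup (Fin q) ℝ)
    (z : Matrix (Fin p) (Fin q) ℝ) : berezin α (rotate k z) = berezin α z := by
  rw [berezin, berezin, det_one_sub_rotate]

theorem rotate_preimage_matrixBall
    (k : orthogonalGroup (Fin p) ℝ × orthogonalGroup (Fin q) ℝ) :
    rotate k ⁻¹' matrixBall p q = matrixBall p q := by
  ext z
  have ha : IsUnit k.1.val := IsUnit.of_mul_eq_one _ ((mem_orthogonalGroup_iff (Fin p) ℝ).1 k.1.2)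
  rw [Set.mem_preimage, mem_matrixBall_iff, mem_matrixBall_iff, one_sub_rotate_mul_transpose,
    Matrix.IsUnit.posDef_star_left_conjugate_iff ha]

theorem measurePreserving_rotate (k : orthogonalGroup (Fin p) ℝ × orthogonalGroup (Fin q) ℝ) :
    MeasurePreserving (rotate k) (invariantMeasure p q) (invariantMeasure p q) := by
  have h1 := (measurePreserving_rotate_volume k).restrict_preimage
    (measurableSet_matrixBall (p := p) (q := q))
  rw [rotate_preimage_matrixBall] at h1
  refine ⟨h1.measurable, Measure.ext fun t ht => ?_⟩
  rw [Measure.map_apply h1.measurable ht]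
  unfold invariantMeasure
  rw [withDensity_apply _ (h1.measurable ht), withDensity_apply _ ht]
  refine Eq.trans (lintegral_congr fun z => ?_)
    (h1.setLIntegral_comp_preimage ht measurable_invariantDensity)
  simp only [det_one_sub_transpose_mul, det_one_sub_rotate]

instance isProbabilityMeasure_haarO (n : ℕ) : IsProbabilityMeasure (haarO n) :=
  ⟨Measure.haarMeasure_self (K₀ := (⊤ : TopologicalSpace.PositiveCompacts _))⟩

theorem measurable_uncurry_rotate : Measurable fun x :
    (orthogonalGroup (Fin p) ℝ × orthogonalGroup (Fin q) ℝ) × Matrix (Fin p) (Fin q) ℝ =>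
      rotate x.1 x.2 := by
  refine measurable_matrix_of fun i j => ?_
  simp only [rotate, mul_apply]
  refine Finset.measurable_sum _ fun k _ => Measurable.mul (Finset.measurable_sum _ fun l _ =>
    Measurable.mul ?_ ?_) ?_
  · exact (measurable_matrix_apply l i).comp
      (measurable_subtype_coe.comp (measurable_fst.comp measurable_fst))
  · exact (measurable_matrix_apply l k).comp measurable_snd
  · exact (measurable_matrix_apply k j).comp
      (measurable_subtype_coe.comp (measurable_snd.comp measurable_fst))

/-- Averaging over `O(p) × O(q)` does not change the integral against an invariant function,
because the measure on the ball is invariant. -/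
theorem integrable_sphericalFunction_mul_and_integral (h : p ≤ q) (s : Fin p → ℂ) (α : ℝ)
    (hI : Integrable (fun z => psi h s z * ((berezin α z : ℝ) : ℂ)) (invariantMeasure p q)) :
    Integrable (fun z => sphericalFunction h s z * ((berezin α z : ℝ) : ℂ))
      (invariantMeasure p q) ∧
    ∫ z, sphericalFunction h s z * ((berezin α z : ℝ) : ℂ) ∂(invariantMeasure p q) =
      ∫ z, psi h s z * ((berezin α z : ℝ) : ℂ) ∂(invariantMeasure p q) := by
  let f : Matrix (Fin p) (Fin q) ℝ → ℂ := fun z => psi h s z * ((berezin α z : ℝ) : ℂ)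
  have hf : Measurable f := (measurable_psi h s).mul
    (Complex.measurable_ofReal.comp (measurable_berezin α))
  let G : (orthogonalGroup (Fin p) ℝ × orthogonalGroup (Fin q) ℝ) × Matrix (Fin p) (Fin q) ℝ → ℂ :=
    fun x => f (rotate x.1 x.2)
  have t : Transfers (((haarO p).prod (haarO q)).prod (invariantMeasure p q))
      (((haarO p).prod (haarO q)).prod (invariantMeasure p q)) G fun x => f x.2 :=
    Transfers.prod (hf.comp measurable_uncurry_rotate).aestronglyMeasurable fun k =>
      Transfers.of_measurePreserving (measurePreserving_rotate k) f
  have hf2 : Integrable (fun x : (orthogonalGroup (Fin p) ℝ × orthogonalGroup (Fin q) ℝ) ×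
      Matrix (Fin p) (Fin q) ℝ => f x.2)
      (((haarO p).prod (haarO q)).prod (invariantMeasure p q)) := hI.comp_snd _
  obtain ⟨hG, -, hGv⟩ := t hf2
  have hslice : ∀ z, ∫ k, G (k, z) ∂((haarO p).prod (haarO q)) =
      sphericalFunction h s z * ((berezin α z : ℝ) : ℂ) := by
    intro z
    simp only [G, f, berezin_rotate]
    rw [integral_mul_const]
    rfl
  have h1 := hG.integral_prod_right
  have h2 := integral_prod_symm G hG
  simp only [hslice] at h1 h2
  refine ⟨h1, h2.symm.trans (hGv.trans ?_)⟩
  rw [integral_prod _ hf2]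
  simp [f]

end Invariance

/-! ### The spherical transform -/

section Coordinates

variable {p q : ℕ}

/-- The columns of `z = (z₁ z₂)`, where `z₂` is square. -/
def splitBlocks (h : p ≤ q) (z : Fin p → Fin q → ℝ) :
    (Fin p → Fin (q - p) → ℝ) × (Fin p → Fin p → ℝ) :=
  (fun i j => z i (splitCols h (Sum.inl j)), fun i j => z i (splitCols h (Sum.inr j)))

theorem measurePreserving_splitBlocks (h : p ≤ q) : MeasurePreserving (splitBlocks h) := by
  have h1 := volume_preserving_pi fun _ : Fin p =>
    (volume_measurePreserving_sumPiEquivProdPi (fun _ : Fin (q - p) ⊕ Fin p => ℝ)).comp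
      (volume_measurePreserving_piCongrLeft (fun _ : Fin q => ℝ) (splitCols h)).symm
  exact (volume_measurePreserving_arrowProdEquivProdArrow _ _ (Fin p)).comp h1

theorem mul_transpose_eq_splitBlocks (h : p ≤ q) (z : Matrix (Fin p) (Fin q) ℝ) :
    z * zᵀ = of (splitBlocks h z).1 * (of (splitBlocks h z).1)ᵀ +
      of (splitBlocks h z).2 * (of (splitBlocks h z).2)ᵀ := by
  ext i j
  simp only [mul_apply, Matrix.add_apply, transpose_apply, of_apply, splitBlocks]
  rw [← (splitCols h).sum_comp, Fintype.sum_sum_type]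

/-- The symmetric matrix `(X + Xᵗ)/2 - L Lᵗ` in terms of `z₁` and `z₂`. -/
noncomputable def ballGram {κ : Type*} [Fintype κ] (z : (Fin p → κ → ℝ) × (Fin p → Fin p → ℝ)) :
    Matrix (Fin p) (Fin p) ℝ :=
  symGram (of (cayleyMap z.2)) (of (-((1 + of z.2)⁻¹ * of z.1)))

/-- The congruence behind the Cayley transform: `1 - z zᵗ = (1 + z₂) Y (1 + z₂)ᵗ`, where
`Y = M - L Lᵗ`. It identifies the ball with the set where `Y` is positive definite. -/
theorem one_sub_eq_mul_ballGram_mul {κ : Type*} [Fintype κ]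
    (z : (Fin p → κ → ℝ) × (Fin p → Fin p → ℝ)) (hz : (1 + of z.2).det ≠ 0) :
    1 - (of z.1 * (of z.1)ᵀ + of z.2 * (of z.2)ᵀ) =
      (1 + of z.2) * ballGram z * (1 + of z.2)ᵀ := by
  set A : Matrix (Fin p) (Fin p) ℝ := 1 + of z.2 with hA
  have hu : IsUnit A.det := Ne.isUnit hz
  have h1 : A * A⁻¹ = 1 := mul_nonsing_inv A hu
  have h1' : (A⁻¹)ᵀ * Aᵀ = 1 := by rw [← transpose_mul, h1, transpose_one]
  have hX : A * of (cayleyMap z.2) = (2 : ℝ) • 1 - A := by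
    rw [of_cayleyMap, Matrix.mul_sub, Matrix.mul_smul, h1, Matrix.mul_one]
  have hX' : (of (cayleyMap z.2))ᵀ * Aᵀ = (2 : ℝ) • 1 - Aᵀ := by
    rw [← transpose_mul, hX, transpose_sub, transpose_smul, transpose_one]
  have hL : A * of (-(A⁻¹ * of z.1)) = -of z.1 := by
    change A * -(A⁻¹ * of z.1) = -of z.1
    rw [Matrix.mul_neg, ← Matrix.mul_assoc, h1, Matrix.one_mul]
  have hL' : (of (-(A⁻¹ * of z.1)))ᵀ * Aᵀ = -(of z.1)ᵀ := by
    rw [← transpose_mul, hL, transpose_neg]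
  have hz2 : of z.2 = A - 1 := by rw [hA]; abel
  have e1 : A * ballGram z * Aᵀ = (1 / 2 : ℝ) • (A * of (cayleyMap z.2) * Aᵀ +
      A * ((of (cayleyMap z.2))ᵀ * Aᵀ)) -
      (A * of (-(A⁻¹ * of z.1))) * ((of (-(A⁻¹ * of z.1)))ᵀ * Aᵀ) := by
    simp only [ballGram, symGram, ← hA, Matrix.mul_sub, Matrix.sub_mul, Matrix.mul_add,
      Matrix.add_mul, Matrix.mul_smul, Matrix.smul_mul, Matrix.mul_assoc]
  rw [e1, hX, hX', hL, hL', hz2]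
  simp only [Matrix.mul_sub, Matrix.sub_mul, Matrix.mul_neg, Matrix.neg_mul, Matrix.mul_smul,
    Matrix.smul_mul, Matrix.mul_one, Matrix.one_mul, transpose_sub, transpose_one]
  module

/-- A vector with `v z₂ = -v` would satisfy `|v z| ≥ |v|`. -/
theorem det_one_add_ne_zero_of_posDef {κ : Type*} [Fintype κ]
    (z : (Fin p → κ → ℝ) × (Fin p → Fin p → ℝ))
    (h : (1 - (of z.1 * (of z.1)ᵀ + of z.2 * (of z.2)ᵀ)).PosDef) : (1 + of z.2).det ≠ 0 := by
  intro h0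
  rw [← det_transpose] at h0
  obtain ⟨v, hv, hv0⟩ := exists_mulVec_eq_zero_iff.2 h0
  have h1 : (of z.2)ᵀ *ᵥ v = -v := by
    rw [transpose_add, transpose_one, add_mulVec, one_mulVec] at hv0
    exact (neg_eq_of_add_eq_zero_right hv0).symm
  have h2 := h.dotProduct_mulVec_pos hv
  have h4 := dotProduct_mul_transpose_mulVec (of z.2) v
  rw [h1, neg_dotProduct_neg] at h4
  rw [star_trivial, sub_mulVec, one_mulVec, add_mulVec, dotProduct_sub, dotProduct_add,
    dotProduct_mul_transpose_mulVec, h4] at h2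
  have h3 : 0 ≤ ((of z.1)ᵀ *ᵥ v) ⬝ᵥ ((of z.1)ᵀ *ᵥ v) :=
    Finset.sum_nonneg fun i _ => mul_self_nonneg _
  linarith

theorem wedgeSchur_cayley_squareBlock (h : p ≤ q) (z : Matrix (Fin p) (Fin q) ℝ)
    (hz : (1 + of (splitBlocks h z).2).det ≠ 0) :
    wedgeSchur (cayley (squareBlock h z)) = ballGram (splitBlocks h z) := by
  set z₁ : Matrix (Fin p) (Fin (q - p)) ℝ := of (splitBlocks h z).1 with hz₁
  set z₂ : Matrix (Fin p) (Fin p) ℝ := of (splitBlocks h z).2 with hz₂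
  set X : Matrix (Fin p) (Fin p) ℝ := of (cayleyMap (splitBlocks h z).2) with hX
  have hu : IsUnit (1 + z₂).det := Ne.isUnit hz
  have hXz : X * (1 + z₂) = 1 - z₂ := by
    rw [hX, of_cayleyMap, ← hz₂, Matrix.sub_mul, Matrix.smul_mul, nonsing_inv_mul _ hu,
      Matrix.one_mul]
    module
  have hX1 : X * z₁ = (2 : ℝ) • ((1 + z₂)⁻¹ * z₁) - z₁ := by
    rw [hX, of_cayleyMap, ← hz₂, Matrix.sub_mul, Matrix.smul_mul, Matrix.one_mul]
  have hsq : squareBlock h z = fromBlocks 0 0 z₁ z₂ := rfl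
  have h1 : (1 : Matrix (Fin (q - p) ⊕ Fin p) (Fin (q - p) ⊕ Fin p) ℝ) = fromBlocks 1 0 0 1 :=
    fromBlocks_one.symm
  have hadd : 1 + squareBlock h z = fromBlocks 1 0 z₁ (1 + z₂) := by
    rw [hsq, h1, fromBlocks_add]; simp
  have hsub : 1 - squareBlock h z = fromBlocks 1 0 (-z₁) (1 - z₂) := by
    rw [hsq, h1, sub_eq_add_neg, fromBlocks_neg, fromBlocks_add]; simp [sub_eq_add_neg]
  have hdet : IsUnit (1 + squareBlock h z).det := by
    rw [hadd, det_fromBlocks_zero₁₂, det_one, one_mul]; exact hu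
  have hcay : cayley (squareBlock h z) =
      fromBlocks 1 0 ((2 : ℝ) • (-((1 + z₂)⁻¹ * z₁))) X := by
    rw [cayley, ← mul_nonsing_inv_cancel_right _
      (fromBlocks 1 0 ((2 : ℝ) • (-((1 + z₂)⁻¹ * z₁))) X) hdet]
    congr 1
    rw [hadd, hsub, fromBlocks_multiply]
    congr 1
    · simp
    · simp
    · rw [hX1, Matrix.mul_one]; module
    · rw [hXz]; simp
  rw [hcay]
  simp only [wedgeSchur, toBlocks_fromBlocks₂₁, toBlocks_fromBlocks₂₂, ballGram, symGram]
  rw [smul_smul, show (1 / 2 : ℝ) * 2 = 1 by norm_num, one_smul]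
  rfl

end Coordinates

section Exponents

/-- Sums of the exponents of `psi` over final segments telescope. -/
theorem sum_psiExponent {p : ℕ} (q : ℕ) (s : Fin p → ℂ) (k : Fin p) :
    ∑ j, (if k ≤ j then psiExponent q s j else 0) = (s k + ((q : ℂ) - p) / 2 + k) / 2 := by
  -- The expected value of the sum over `i ≥ j`, and `0` for `j = p`.
  let T : ℕ → ℂ := fun j => if h : j < p then (s ⟨j, h⟩ + ((q : ℂ) - p) / 2 + j) / 2 else 0
  have hpsi : ∀ j : Fin p, psiExponent q s j = T j - T (j + 1) := by
    intro j
    by_cases h : (j : ℕ) + 1 < p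
    · simp only [T, psiExponent, dif_pos h, dif_pos j.2]
      push_cast
      ring
    · have hj : (p : ℂ) = j + 1 := by exact_mod_cast (by omega : p = j + 1)
      simp only [T, psiExponent, dif_neg h, dif_pos j.2, hj]
      ring
  have htel : ∀ n, (k : ℕ) ≤ n →
      ∑ j ∈ Finset.range n, (if (k : ℕ) ≤ j then T j - T (j + 1) else 0) = T k - T n := by
    intro n hn
    induction n, hn using Nat.le_induction with
    | base =>
      rw [sub_self]
      exact Finset.sum_eq_zero fun j hj => if_neg (by simpa using hj)
    | succ n hn ih => rw [Finset.sum_range_succ, ih, if_pos hn]; ring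
  simp only [hpsi, Fin.le_def]
  rw [Fin.sum_univ_eq_sum_range (fun j => if (k : ℕ) ≤ j then T j - T (j + 1) else 0) p,
    htel p k.2.le]
  simp [T]

theorem prod_two_pow (p : ℕ) :
    ∏ k : Fin p, (2 : ℝ) ^ (p - 1 - (k : ℕ)) = 2 ^ ((p : ℝ) * (p - 1) / 2) := by
  rw [Fin.prod_univ_eq_prod_range (fun k => (2 : ℝ) ^ (p - 1 - k)) p,
    Finset.prod_range_reflect (fun k => (2 : ℝ) ^ k) p]
  induction p with
  | zero => simp
  | succ n ih =>
    rw [Finset.prod_range_succ, ih, ← Real.rpow_natCast, ← Real.rpow_add two_pos]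
    congr 1; push_cast; ring

theorem prod_pi_rpow (p : ℕ) (m : ℝ) :
    ∏ k : Fin p, Real.pi ^ ((m + 2 * (k : ℕ)) / 2) = Real.pi ^ ((p : ℝ) * (m + p - 1) / 2) := by
  rw [Fin.prod_univ_eq_prod_range (fun k => Real.pi ^ ((m + 2 * (k : ℕ)) / 2)) p]
  induction p with
  | zero => simp
  | succ n ih =>
    rw [Finset.prod_range_succ, ih, ← Real.rpow_add Real.pi_pos]
    congr 1; push_cast; ring

theorem prod_Gamma_sub (p : ℕ) (α : ℝ) :
    ∏ k : Fin p, Real.Gamma (α - (p - 1 - k : ℕ)) =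
      ∏ j ∈ Finset.Icc 1 p, Real.Gamma (α - (j : ℝ) + 1) := by
  rw [Fin.prod_univ_eq_prod_range (fun k => Real.Gamma (α - (p - 1 - k : ℕ))) p,
    Finset.prod_range_reflect (fun k => Real.Gamma (α - (k : ℕ))) p,
    ← Finset.Ico_add_one_right_eq_Icc, Finset.prod_Ico_eq_prod_range]
  refine Finset.prod_congr rfl fun k _ => ?_
  congr 1; push_cast; ring

end Exponents

section Integral

variable {p q : ℕ}

/-- The exponents of the pivots of `ballGram` in `psi * berezin`, relative to Lebesgue measure:
the first summand comes from `psi`, the second one, the same for all pivots, from the power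
`(α - (p + q))/2` of the determinant. -/
noncomputable def ballExponent (q : ℕ) (α : ℝ) (s : Fin p → ℂ) (k : Fin p) : ℂ :=
  (s k + ((q : ℂ) - p) / 2 + k) / 2 + (((α - (p + q)) / 2 : ℝ) : ℂ)

/-- In the Cayley coordinates the integrand `psi * berezin`, including the density of the
invariant measure, is a constant multiple of `tubeDensity`. -/
theorem psi_mul_density_eq_cayleyPullback (h : p ≤ q) (α : ℝ) (s : Fin p → ℂ)
    (z : Matrix (Fin p) (Fin q) ℝ) :
    (matrixBall p q).indicator (fun z => (((1 - zᵀ * z).det ^ (-((p : ℝ) + q) / 2) : ℝ) : ℂ) *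
        (psi h s z * ((berezin α z : ℝ) : ℂ))) z =
      ((2 ^ ((p : ℝ) * (α - p)) : ℝ) : ℂ) *
        cayleyPullback (tubeDensity (ballExponent q α s) α) (splitBlocks h z) := by
  have hgram := mul_transpose_eq_splitBlocks h z
  by_cases hz : (1 + of (splitBlocks h z).2).det = 0
  · have hnot : z ∉ matrixBall p q := fun hmem => by
      rw [mem_matrixBall_iff, hgram] at hmem
      exact det_one_add_ne_zero_of_posDef _ hmem hz
    rw [Set.indicator_of_notMem hnot, cayleyPullback, if_neg (not_not.2 hz), mul_zero]
  have hfac := one_sub_eq_mul_ballGram_mul (splitBlocks h z) hz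
  rw [← hgram] at hfac
  set Y := ballGram (splitBlocks h z) with hY
  set δ := |(1 + of (splitBlocks h z).2).det| with hδ
  have hδ0 : 0 < δ := abs_pos.2 hz
  have hball : z ∈ matrixBall p q ↔ Y.PosDef := by
    have hu : IsUnit (1 + of (splitBlocks h z).2)ᵀ := by
      rw [isUnit_iff_isUnit_det, det_transpose]; exact Ne.isUnit hz
    rw [mem_matrixBall_iff, hfac]
    have := Matrix.IsUnit.posDef_star_left_conjugate_iff (x := Y) hu
    rwa [star_eq_conjTranspose, conjTranspose_eq_transpose_of_trivial, transpose_transpose] at this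
  rw [cayleyPullback, if_pos hz, tubeDensity]
  change _ = _ * (_ * (pivotPower _ Y * _))
  by_cases hpos : Y.PosDef
  swap
  · have h0 : pivotPower (ballExponent q α s) Y = 0 :=
      pivotPower_eq_zero _ (isHermitian_symGram _ _) hpos
    rw [Set.indicator_of_notMem (fun hm => hpos (hball.1 hm)), h0, zero_mul, mul_zero, mul_zero]
  have hYdet : 0 < Y.det := hpos.det_pos
  have hdet : (1 - z * zᵀ).det = δ ^ 2 * Y.det := by
    rw [hfac, det_mul, det_mul, det_transpose, hδ, sq_abs]; ring
  have hpsi : psi h s z = pivotPower (fun k => (s k + ((q : ℂ) - p) / 2 + k) / 2) Y := by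
    rw [psi, wedgeSchur_cayley_squareBlock h z hz, prod_leadingMinor_cpow _ hpos]
    simp only [sum_psiExponent]
  have hpow : pivotPower (ballExponent q α s) Y = psi h s z *
      ((Y.det ^ ((α - (p + q)) / 2) : ℝ) : ℂ) := by
    rw [hpsi, Complex.ofReal_cpow hYdet.le, pivotPower_mul_det_cpow _ _ hpos]
    rfl
  have hX : |(1 + of (cayleyMap (splitBlocks h z).2)).det| = 2 ^ p * δ⁻¹ := by
    rw [det_one_add_cayleyMap, abs_mul, abs_inv, ← hδ]; simp
  have hreal : (δ ^ 2 * Y.det) ^ (-((p : ℝ) + q) / 2) * (δ ^ 2 * Y.det) ^ (α / 2) =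
      2 ^ ((p : ℝ) * (α - p)) * (2 ^ (p * p) * δ⁻¹ ^ (2 * p + Fintype.card (Fin (q - p)))) *
        (Y.det ^ ((α - (p + q)) / 2) * (2 ^ p * δ⁻¹) ^ (-α)) := by
    have hc : ((2 * p + Fintype.card (Fin (q - p)) : ℕ) : ℝ) = p + q := by
      rw [Fintype.card_fin]
      have : 2 * p + (q - p) = p + q := by omega
      exact_mod_cast this
    have e1 : (δ ^ 2 * Y.det) ^ (-((p : ℝ) + q) / 2) * (δ ^ 2 * Y.det) ^ (α / 2) =
        δ ^ (α - (p + q)) * Y.det ^ ((α - (p + q)) / 2) := by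
      rw [← Real.rpow_add (by positivity), Real.mul_rpow (by positivity) hYdet.le,
        ← Real.rpow_natCast, ← Real.rpow_mul hδ0.le]
      congr 2 <;> push_cast <;> ring
    have e2 : δ⁻¹ ^ (2 * p + Fintype.card (Fin (q - p))) = δ ^ (-((p : ℝ) + q)) := by
      rw [← Real.rpow_natCast, hc, Real.inv_rpow hδ0.le, ← Real.rpow_neg hδ0.le]
    have e3 : ((2 : ℝ) ^ p * δ⁻¹) ^ (-α) = 2 ^ (-(p * α)) * δ ^ α := by
      rw [Real.mul_rpow (by positivity) (by positivity), Real.inv_rpow hδ0.le,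
        ← Real.rpow_neg hδ0.le, neg_neg, ← Real.rpow_natCast, ← Real.rpow_mul two_pos.le]
      congr 2; ring
    have e4 : (2 : ℝ) ^ ((p : ℝ) * (α - p)) * (2 ^ (p * p) * 2 ^ (-((p : ℝ) * α))) = 1 := by
      rw [← Real.rpow_natCast, ← Real.rpow_add two_pos, ← Real.rpow_add two_pos]
      convert Real.rpow_zero 2 using 2
      push_cast
      ring
    have e5 : δ ^ (α - ((p : ℝ) + q)) = δ ^ (-((p : ℝ) + q)) * δ ^ α := by
      rw [← Real.rpow_add hδ0]; congr 1; ring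
    rw [e1, e2, e3, e5]
    linear_combination -(δ ^ (-((p : ℝ) + q)) * δ ^ α * Y.det ^ ((α - (p + q)) / 2)) * e4
  rw [Set.indicator_of_mem (hball.2 hpos), hpow, det_one_sub_transpose_mul, berezin, hdet, hX]
  have hcomplex := congrArg (fun x : ℝ => (x : ℂ)) hreal
  simp only [Complex.ofReal_mul] at hcomplex ⊢
  linear_combination psi h s z * hcomplex

theorem integrable_invariantMeasure_iff (f : Matrix (Fin p) (Fin q) ℝ → ℂ) :
    (Integrable f (invariantMeasure p q) ↔ Integrable ((matrixBall p q).indicator fun z =>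
      (((1 - zᵀ * z).det ^ (-((p : ℝ) + q) / 2) : ℝ) : ℂ) * f z)) ∧
    ∫ z, f z ∂(invariantMeasure p q) = ∫ z, (matrixBall p q).indicator (fun z =>
      (((1 - zᵀ * z).det ^ (-((p : ℝ) + q) / 2) : ℝ) : ℂ) * f z) z := by
  have hb := measurableSet_matrixBall (p := p) (q := q)
  have hfin : ∀ᵐ z ∂(volume.restrict (matrixBall p q)), invariantDensity p q z < ⊤ :=
    Filter.Eventually.of_forall fun z => ENNReal.ofReal_lt_top
  have heq : ∀ z ∈ matrixBall p q, (invariantDensity p q z).toReal • f z =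
      (((1 - zᵀ * z).det ^ (-((p : ℝ) + q) / 2) : ℝ) : ℂ) * f z := by
    intro z hz
    have : 0 < (1 - zᵀ * z).det := by
      rw [det_one_sub_transpose_mul]
      exact ((mem_matrixBall_iff z).1 hz).det_pos
    rw [invariantDensity, ENNReal.toReal_ofReal (by positivity), Complex.real_smul]
  constructor
  · rw [integrable_indicator_iff hb]
    refine (integrable_withDensity_iff_integrable_smul' measurable_invariantDensity hfin).trans ?_
    exact integrableOn_congr_fun heq hb
  · rw [integral_indicator hb]
    refine (integral_withDensity_eq_integral_toReal_smul measurable_invariantDensity hfin f).trans ?_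
    exact setIntegral_congr_fun hb heq

/-- The arguments of the Gamma functions in `tubeFactor`, for the exponents `ballExponent`. -/
theorem ballExponent_add (h : p ≤ q) (α : ℝ) (s : Fin p → ℂ) (k : Fin p) :
    ballExponent q α s k + (p - 1 - k : ℕ) / 2 + 1 =
      ((α : ℂ) - ((p : ℂ) + q) / 2 + 1 + s k) / 2 ∧
    (α : ℂ) - (p - 1 - k : ℕ) - (ballExponent q α s k + (p - 1 - k : ℕ) / 2 + 1) -
      (q - p + 2 * k : ℕ) / 2 = ((α : ℂ) - ((p : ℂ) + q) / 2 + 1 - s k) / 2 := by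
  have hcast : ((p - 1 - k : ℕ) : ℂ) = p - 1 - k := by
    have := k.2
    rw [Nat.cast_sub (by omega), Nat.cast_sub (by omega)]
    simp
  rw [hcast, ballExponent]
  constructor
  · push_cast; ring
  · push_cast [Nat.cast_sub h]; ring

theorem integrable_psi_mul_berezin_and_integral (h : p ≤ q) {α : ℝ} (hα : α ≠ 0) (s : Fin p → ℂ)
    (hs : ∀ k, |(s k).re| < α - ((p : ℝ) + q) / 2 + 1) :
    Integrable (fun z => psi h s z * ((berezin α z : ℝ) : ℂ)) (invariantMeasure p q) ∧
    ∫ z, psi h s z * ((berezin α z : ℝ) : ℂ) ∂(invariantMeasure p q) =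
      ((2 ^ ((p : ℝ) * (α - p)) : ℝ) : ℂ) *
        ∏ k, tubeFactor p (q - p) (ballExponent q α s) α k := by
  obtain ⟨hT, hTv⟩ := integrable_tubeDensity_and_integral α p (Fin (q - p)) (ballExponent q α s)
    (fun k => by
      rw [(ballExponent_add h α s k).1]
      have := (abs_lt.1 (hs k)).1
      simp
      linarith)
    (fun k => by
      rw [Fintype.card_fin, (ballExponent_add h α s k).2]
      have := (abs_lt.1 (hs k)).2
      simp
      linarith)
  -- The junk value `0 ^ (-α) = 0`, for `α ≠ 0`, disposes of the singular matrices `1 + X`.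
  have hF0 : ∀ x : (Fin p → Fin (q - p) → ℝ) × (Fin p → Fin p → ℝ), (1 + of x.2).det = 0 →
      tubeDensity (ballExponent q α s) α x = 0 := fun x hx => by
    rw [tubeDensity, hx, abs_zero, Real.zero_rpow (neg_ne_zero.2 hα)]
    simp
  have t1 := Transfers.of_measurePreserving (measurePreserving_splitBlocks h)
    (cayleyPullback (tubeDensity (ballExponent q α s) α))
  obtain ⟨hI, -, hIv⟩ :=
    (t1.trans (transfers_cayleyPullback (measurable_tubeDensity _ α) hF0)) hT
  obtain ⟨i1, i2⟩ := integrable_invariantMeasure_iff (p := p) (q := q)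
    fun z => psi h s z * ((berezin α z : ℝ) : ℂ)
  rw [funext (psi_mul_density_eq_cayleyPullback h α s)] at i1 i2
  refine ⟨i1.2 (hI.const_mul _), i2.trans ?_⟩
  rw [integral_const_mul]
  rw [Fintype.card_fin] at hTv
  rw [← hTv, ← hIv]
  rfl

theorem prod_tubeFactor (h : p ≤ q) (α : ℝ) (s : Fin p → ℂ) :
    ((2 ^ ((p : ℝ) * (α - p)) : ℝ) : ℂ) * ∏ k, tubeFactor p (q - p) (ballExponent q α s) α k =
      (((2 : ℝ) ^ ((p : ℝ) * (α - ((p : ℝ) + 1) / 2)) * Real.pi ^ ((p : ℝ) * ((q : ℝ) - 1) / 2) /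
        ∏ j ∈ Finset.Icc 1 p, Real.Gamma (α - (j : ℝ) + 1) : ℝ) : ℂ) *
      ∏ k : Fin p, (Complex.Gamma (((α : ℂ) - ((p : ℂ) + q) / 2 + 1 + s k) / 2) *
        Complex.Gamma (((α : ℂ) - ((p : ℂ) + q) / 2 + 1 - s k) / 2)) := by
  have hfac : ∀ k : Fin p, tubeFactor p (q - p) (ballExponent q α s) α k =
      (((2 : ℝ) ^ (p - 1 - (k : ℕ)) * Real.pi ^ ((((q : ℝ) - p) + 2 * (k : ℕ)) / 2) *
        (Real.Gamma (α - (p - 1 - k : ℕ)))⁻¹ : ℝ) : ℂ) *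
      (Complex.Gamma (((α : ℂ) - ((p : ℂ) + q) / 2 + 1 + s k) / 2) *
        Complex.Gamma (((α : ℂ) - ((p : ℂ) + q) / 2 + 1 - s k) / 2)) := fun k => by
    rw [tubeFactor, (ballExponent_add h α s k).2, (ballExponent_add h α s k).1]
    have hπ : (((q - p + 2 * k : ℕ) : ℝ)) = ((q : ℝ) - p) + 2 * (k : ℕ) := by
      push_cast [Nat.cast_sub h]; ring
    rw [hπ]
    push_cast [← Complex.Gamma_ofReal]
    ring
  have h2 : (2 : ℝ) ^ ((p : ℝ) * (α - ((p : ℝ) + 1) / 2)) =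
      2 ^ ((p : ℝ) * (α - p)) * 2 ^ ((p : ℝ) * (p - 1) / 2) := by
    rw [← Real.rpow_add two_pos]; congr 1; ring
  have hπ : (p : ℝ) * ((q : ℝ) - 1) / 2 = (p : ℝ) * (((q : ℝ) - p) + p - 1) / 2 := by ring
  simp only [hfac]
  rw [Finset.prod_mul_distrib, ← Complex.ofReal_prod, Finset.prod_mul_distrib,
    Finset.prod_mul_distrib, prod_two_pow, prod_pi_rpow, Finset.prod_inv_distrib, prod_Gamma_sub,
    h2, hπ]
  push_cast
  ring

end Integral

end BerezinTransform

theorem corollary3p4 (p q : ℕ) (hp : 1 ≤ p) (hpq : p ≤ q) (α : ℝ)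
    (hα : (p : ℝ) + q - 1 < α) (s : Fin p → ℂ)
    (hs : ∀ k, |(s k).re| < α - ((p : ℝ) + q) / 2 + 1) :
    MeasureTheory.Integrable
      (fun z => BerezinTransform.sphericalFunction hpq s z * ((BerezinTransform.berezin α z : ℝ) : ℂ))
      (BerezinTransform.invariantMeasure p q) ∧
    BerezinTransform.sphericalTransform hpq
      (fun z => ((BerezinTransform.berezin α z : ℝ) : ℂ)) s =
      (((2 : ℝ) ^ ((p : ℝ) * (α - ((p : ℝ) + 1) / 2)) *
          Real.pi ^ ((p : ℝ) * ((q : ℝ) - 1) / 2) /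
          ∏ j ∈ Finset.Icc 1 p, Real.Gamma (α - (j : ℝ) + 1) : ℝ) : ℂ) *
        ∏ k : Fin p,
          (Complex.Gamma (((α : ℂ) - ((p : ℂ) + q) / 2 + 1 + s k) / 2) *
            Complex.Gamma (((α : ℂ) - ((p : ℂ) + q) / 2 + 1 - s k) / 2)) := by
  have hp' : (1 : ℝ) ≤ p := by exact_mod_cast hp
  have hq' : (1 : ℝ) ≤ q := by exact_mod_cast hp.trans hpq
  have hα0 : α ≠ 0 := by linarith
  obtain ⟨hI, hv⟩ := BerezinTransform.integrable_psi_mul_berezin_and_integral hpq hα0 s hs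
  obtain ⟨hΦ, hΦv⟩ :=
    BerezinTransform.integrable_sphericalFunction_mul_and_integral hpq s α hI
  exact ⟨hΦ, hΦv.trans (hv.trans (BerezinTransform.prod_tubeFactor hpq α s))⟩
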